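/- Let $\kappa\le 0$ and $\tau>0$, and let $\mathbb{E}(\kappa,\tau)$ be the simply connected homogeneous 3-manifold given by $\{(x,y,z)\in\mathbb{R}^3:\ 4+\kappa(x^2+y^2)>0\}$ with the Riemannian metric $$\lambda^2(dx^2+dy^2)+\big(\lambda\tau(y\,dx-x\,dy)+dz\big)^2,\qquad \lambda=\frac{4}{4+\kappa(x^2+y^2)},$$ so that $\mathbb{E}(\kappa,\tau)$ is the Heisenberg space $\mathrm{Nil}_3$ if $\kappa=0$ and the universal cover $\widetilde{SL_2}(\mathbb{R})$ of $SL_2(\mathbb{R})$ if $\kappa<0$. Let $\xi=\partial_z$ be the unit vertical Killing field, and let $$\mathfrak{C}^1=\{\mathfrak{h}\in C^1([-1,1]):\ \mathfrak{h}(y)=\mathfrak{h}(-y)>0\ \text{ and }\ 4\mathfrak{h}(y)^2+\kappa(1-y^2)>0\ \text{ for all } y\in[-1,1]\}.$$ For $\mathfrak{h}\in\mathfrak{C}^1$, a rotational $\mathfrak{h}$-torus is an immersed ($C^2$) torus $\psi(u,\theta)=(x(u)\cos\theta,x(u)\sin\theta,z(u))$, generated by rotating a closed curve $(x(u),0,z(u))$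 with $x>0$ around the $z$-axis, which admits a continuous unit normal field $\eta$ such that the mean curvature (the average of the principal curvatures) with respect to $\eta$ is $H=\mathfrak{h}(\langle\eta,\xi\rangle)$ at each point. 1. If $\mathfrak{h}\in\mathfrak{C}^1$ is non-increasing on $[-1,0]$, then there are no rotational $\mathfrak{h}$-tori in $\mathbb{E}(\kappa,\tau)$. 2. There exists $\mathfrak{h}\in\mathfrak{C}^1$ for which there is an embedded rotational $\mathfrak{h}$-torus in $\mathbb{E}(\kappa,\tau)$. -/

import Mathlib

/-! # The spaces `E(κ, τ)` in coordinates, and surfaces of prescribed mean curvature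

Points and tangent vectors of the coordinate model are both written as elements of `Fin 3 → ℝ`
(coordinates `(x, y, z)` and components in the basis `∂x, ∂y, ∂z`). -/

noncomputable section

namespace EKT

/-- The underlying set of the model `R(κ, τ)` for `κ ≤ 0`: all of `ℝ³` if `κ = 0`, and the open
solid cylinder `x² + y² < 4 / (-κ)` (disk of radius `2 / √(-κ)` times `ℝ`) if `κ < 0`. -/
def model (κ : ℝ) : Set (Fin 3 → ℝ) :=
  {p | 0 < 4 + κ * (p 0 ^ 2 + p 1 ^ 2)}

/-- The conformal factor `4 / (4 + κ (x² + y²))`. -/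
def conf (κ : ℝ) (p : Fin 3 → ℝ) : ℝ :=
  4 / (4 + κ * (p 0 ^ 2 + p 1 ^ 2))

/-- The Riemannian metric
`λ² (dx² + dy²) + (λ τ (y dx - x dy) + dz)²` of `E(κ, τ)` at `p`, evaluated on `v, w`. -/
def metric (κ τ : ℝ) (p v w : Fin 3 → ℝ) : ℝ :=
  conf κ p ^ 2 * (v 0 * w 0 + v 1 * w 1) +
    (conf κ p * τ * (p 1 * v 0 - p 0 * v 1) + v 2) *
      (conf κ p * τ * (p 1 * w 0 - p 0 * w 1) + w 2)

/-- The vertical unit Killing field `ξ = ∂z`. -/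
def xi : Fin 3 → ℝ := ![0, 0, 1]

/-- Christoffel symbols of the first kind, as a trilinear expression:
`Γ(v, w, n) = (∂_v g(w, n) + ∂_w g(v, n) - ∂_n g(v, w)) / 2` for constant `v, w, n`.
By the Koszul formula this is `⟨∇_v w, n⟩` for the Levi-Civita connection and the
constant-coefficient extension of `w`. -/
def christoffel (κ τ : ℝ) (p v w n : Fin 3 → ℝ) : ℝ :=
  (fderiv ℝ (fun q => metric κ τ q w n) p v + fderiv ℝ (fun q => metric κ τ q v n) p w
    - fderiv ℝ (fun q => metric κ τ q v w) p n) / 2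

section Surface

variable (κ τ : ℝ) (ψ : ℝ → ℝ → Fin 3 → ℝ)

/-- `∂ψ/∂u`. -/
def du (u v : ℝ) : Fin 3 → ℝ := deriv (fun t => ψ t v) u

/-- `∂ψ/∂v`. -/
def dv (u v : ℝ) : Fin 3 → ℝ := deriv (fun t => ψ u t) v

/-- First fundamental form, coefficient `E = ⟨ψ_u, ψ_u⟩`. -/
def fundE (u v : ℝ) : ℝ := metric κ τ (ψ u v) (du ψ u v) (du ψ u v)

/-- First fundamental form, coefficient `F = ⟨ψ_u, ψ_v⟩`. -/
def fundF (u v : ℝ) : ℝ := metric κ τ (ψ u v) (du ψ u v) (dv ψ u v)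

/-- First fundamental form, coefficient `G = ⟨ψ_v, ψ_v⟩`. -/
def fundG (u v : ℝ) : ℝ := metric κ τ (ψ u v) (dv ψ u v) (dv ψ u v)

/-- Second fundamental form, coefficient `⟨∇_{ψ_u} ψ_u, n⟩`. -/
def secondUU (n : Fin 3 → ℝ) (u v : ℝ) : ℝ :=
  metric κ τ (ψ u v) (du (du ψ) u v) n + christoffel κ τ (ψ u v) (du ψ u v) (du ψ u v) n

/-- Second fundamental form, coefficient `⟨∇_{ψ_u} ψ_v, n⟩`. -/
def secondUV (n : Fin 3 → ℝ) (u v : ℝ) : ℝ :=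
  metric κ τ (ψ u v) (du (dv ψ) u v) n + christoffel κ τ (ψ u v) (du ψ u v) (dv ψ u v) n

/-- Second fundamental form, coefficient `⟨∇_{ψ_v} ψ_v, n⟩`. -/
def secondVV (n : Fin 3 → ℝ) (u v : ℝ) : ℝ :=
  metric κ τ (ψ u v) (dv (dv ψ) u v) n + christoffel κ τ (ψ u v) (dv ψ u v) (dv ψ u v) n

/-- The mean curvature (average of the principal curvatures, i.e. half the trace of the second
fundamental form with respect to the first) of the immersion `ψ` with unit normal `η`. -/
def meanCurvature (η : ℝ → ℝ → Fin 3 → ℝ) (u v : ℝ) : ℝ :=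
  (fundE κ τ ψ u v * secondVV κ τ ψ (η u v) u v
      - 2 * fundF κ τ ψ u v * secondUV κ τ ψ (η u v) u v
      + fundG κ τ ψ u v * secondUU κ τ ψ (η u v) u v) /
    (2 * (fundE κ τ ψ u v * fundG κ τ ψ u v - fundF κ τ ψ u v ^ 2))

/-- The angle function `⟨η, ξ⟩`. -/
def angle (η : ℝ → ℝ → Fin 3 → ℝ) (u v : ℝ) : ℝ := metric κ τ (ψ u v) (η u v) xi

end Surface

/-- `ψ` induces a `C²` immersion of the torus `(ℝ / P ℤ) × (ℝ / Q ℤ)` into the model. -/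
structure IsImmersedTorus (κ P Q : ℝ) (ψ : ℝ → ℝ → Fin 3 → ℝ) : Prop where
  pos_left : 0 < P
  pos_right : 0 < Q
  periodic_left : ∀ u v, ψ (u + P) v = ψ u v
  periodic_right : ∀ u v, ψ u (v + Q) = ψ u v
  contDiff : ContDiff ℝ 2 (fun p : ℝ × ℝ => ψ p.1 p.2)
  mem_model : ∀ u v, ψ u v ∈ model κ
  immersion : ∀ u v, LinearIndependent ℝ ![du ψ u v, dv ψ u v]

/-- `η` is a continuous unit normal vector field on the torus `(ℝ / P ℤ) × (ℝ / Q ℤ)` immersed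
by `ψ`, i.e. an orientation of it. -/
structure IsUnitNormal (κ τ P Q : ℝ) (ψ η : ℝ → ℝ → Fin 3 → ℝ) : Prop where
  periodic_left : ∀ u v, η (u + P) v = η u v
  periodic_right : ∀ u v, η u (v + Q) = η u v
  continuous : Continuous (fun p : ℝ × ℝ => η p.1 p.2)
  unit : ∀ u v, metric κ τ (ψ u v) (η u v) (η u v) = 1
  normal_left : ∀ u v, metric κ τ (ψ u v) (η u v) (du ψ u v) = 0
  normal_right : ∀ u v, metric κ τ (ψ u v) (η u v) (dv ψ u v) = 0

/-- The immersed torus `ψ`, suitably oriented, has prescribed mean curvature `𝔥`: at each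
point `H = 𝔥(⟨η, ξ⟩)`. -/
def IsHTorus (κ τ : ℝ) (h : ℝ → ℝ) (P Q : ℝ) (ψ : ℝ → ℝ → Fin 3 → ℝ) : Prop :=
  IsImmersedTorus κ P Q ψ ∧
    ∃ η : ℝ → ℝ → Fin 3 → ℝ, IsUnitNormal κ τ P Q ψ η ∧
      ∀ u v, meanCurvature κ τ ψ η u v = h (angle κ τ ψ η u v)

/-- The map induced by `ψ` on the torus `(ℝ / P ℤ) × (ℝ / Q ℤ)` is injective; an immersed
torus with this property is embedded, by compactness. -/
def IsInjectiveTorus (P Q : ℝ) (ψ : ℝ → ℝ → Fin 3 → ℝ) : Prop :=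
  ∀ u v u' v', ψ u v = ψ u' v' → (∃ m : ℤ, u' = u + m * P) ∧ ∃ n : ℤ, v' = v + n * Q

/-- The rotation of angle `θ` around the `E₃`-axis, an isometry of the model. -/
def rotation (θ : ℝ) (p : Fin 3 → ℝ) : Fin 3 → ℝ :=
  ![p 0 * Real.cos θ - p 1 * Real.sin θ, p 0 * Real.sin θ + p 1 * Real.cos θ, p 2]

/-- The surface generated by rotating the curve `u ↦ (x(u), 0, z(u))` around the `E₃`-axis. -/
def rotationSurface (x z : ℝ → ℝ) (u θ : ℝ) : Fin 3 → ℝ :=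
  rotation θ ![x u, 0, z u]

/-- A rotational `𝔥`-torus: the rotation around the `E₃`-axis of a closed curve
`u ↦ (x(u), 0, z(u))`, `u ∈ ℝ / T ℤ`, with `x > 0`, which is an `𝔥`-surface. -/
def IsRotationalHTorus (κ τ : ℝ) (h : ℝ → ℝ) (T : ℝ) (x z : ℝ → ℝ) : Prop :=
  (∀ u, 0 < x u) ∧ IsHTorus κ τ h T (2 * Real.pi) (rotationSurface x z)

/-- The class `ℭ¹` of even positive `C¹` functions `𝔥` on `[-1, 1]` with
`4 𝔥(y)² + κ (1 - y²) > 0`. -/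
structure PrescribedClass (κ : ℝ) (h : ℝ → ℝ) : Prop where
  contDiffOn : ContDiffOn ℝ 1 h (Set.Icc (-1) 1)
  even : ∀ y ∈ Set.Icc (-1 : ℝ) 1, h (-y) = h y
  pos : ∀ y ∈ Set.Icc (-1 : ℝ) 1, 0 < h y
  bound : ∀ y ∈ Set.Icc (-1 : ℝ) 1, 0 < 4 * h y ^ 2 + κ * (1 - y ^ 2)

end EKT

end

/-!
The meridian of a rotational surface is best described by the direction `(ω, σ)` of its velocity in
the orbit space: `ω` is proportional to `x'`, `σ` to `z'`, and the angle function is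
`ν = ω / √(1 + τ² x²)`. The mean curvature formula (`meanCurvature_rotationSurface_frame`) says that
this direction rotates with speed proportional to `2 H - c σ`, where `c > 0` is the curvature of the
circle of radius `x` in the base; in particular `λ x σ` increases exactly when `x` does. A rotational
`𝔥`-torus is thus a periodic solution of the first-order system `ProfileCurve`.

*Nonexistence.* Follow a periodic solution from a point where it is vertical and descending
(`σ = -1`, a strict local minimum of `x`). It moves outwards, first descending and then ascending,
to a point with `σ = 1`. Compare the two parts at points with opposite `σ`: the outer one has
smaller `|ν|`, hence smaller `𝔥` if `𝔥` is non-increasing on `[-1, 0]`, and its direction rotates more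
slowly both because of this and because of the sign of `c σ`. So the outer part rises more than the
inner part drops (`ProfileCurve.lt_of_sin_eq`). The same holds, traversed backwards, for the arc
that returns to the next point with `σ = -1`, and between the two arcs the curve ascends. Hence each
point with `σ = -1` is followed by a higher one (`ProfileCurve.exists_higher`), which is impossible
on a closed curve.

*Existence.* If `2 𝔥 > c` on an annulus, the direction angle `φ` can serve as parameter, and `x`
becomes a function `X` of `w = sin φ` satisfying a regular scalar equation (`radialRate`). So `x(φ)`
is automatically `2π`-periodic and symmetric under `φ ↦ π - φ`, and the meridian closes as soon as
the height difference between `φ = -π/2` and `φ = π/2` vanishes; it is then convex in shape and the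
torus is embedded. The inner part of an arc reaches larger values of `|ν|` than the outer part.
Let `𝔥` be small for `|ν|` above the value at the starting point and very large below it: the arc
drops. For arcs starting further out only the constant value of `𝔥` is seen, and the comparison above
shows that they rise. By continuity some arc closes
(`exists_isArc_integral_eq_zero`).
-/

noncomputable section

namespace EKT

/-! ### Derivatives of the metric and mean curvature of rotational surfaces -/

/-- The conformal factor `λ` of the metric, as a function of the coordinate distance `x` to the
rotation axis. -/
def lam (κ x : ℝ) : ℝ := 4 / (4 + κ * x ^ 2)

/-- `√(1 + τ² x²)`, the ratio of the length of the rotation orbit through `(x, 0, z)` to the length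
of its projection to the base. The angle function of a rotational surface is at most `1 / rad τ x`
in absolute value. -/
def rad (τ x : ℝ) : ℝ := √(1 + τ ^ 2 * x ^ 2)

/-- The geodesic curvature of the circle of coordinate radius `x` about the origin, in the base
surface of constant curvature `κ`. It equals `1 / x - κ x / 4`, the logarithmic derivative of
`λ x` divided by `λ`. -/
def crv (κ x : ℝ) : ℝ := (4 - κ * x ^ 2) / (4 * x)

/-- The derivative of the conformal factor `conf κ` at `p` in the direction `n`. -/
def dconf (κ : ℝ) (p n : Fin 3 → ℝ) : ℝ := -(κ / 2) * conf κ p ^ 2 * (p 0 * n 0 + p 1 * n 1)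

/-- The derivative at `p`, in the direction `n`, of the metric evaluated on the constant fields
`v` and `w`. -/
def dmetric (κ τ : ℝ) (p v w n : Fin 3 → ℝ) : ℝ :=
  2 * conf κ p * dconf κ p n * (v 0 * w 0 + v 1 * w 1) +
    (dconf κ p n * τ * (p 1 * v 0 - p 0 * v 1) + conf κ p * τ * (n 1 * v 0 - n 0 * v 1)) *
      (conf κ p * τ * (p 1 * w 0 - p 0 * w 1) + w 2) +
    (conf κ p * τ * (p 1 * v 0 - p 0 * v 1) + v 2) *
      (dconf κ p n * τ * (p 1 * w 0 - p 0 * w 1) + conf κ p * τ * (n 1 * w 0 - n 0 * w 1))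

theorem fderiv_metric {κ τ : ℝ} {p : Fin 3 → ℝ} (hp : p ∈ model κ) (v w n : Fin 3 → ℝ) :
    fderiv ℝ (fun q => metric κ τ q v w) p n = dmetric κ τ p v w n := by
  have hp' : 4 + κ * (p 0 ^ 2 + p 1 ^ 2) ≠ 0 := ne_of_gt hp
  have hd : DifferentiableAt ℝ (fun q => metric κ τ q v w) p := by
    unfold metric conf
    fun_prop (disch := assumption)
  rw [← hd.lineDeriv_eq_fderiv]
  have h0 : ∀ i, HasDerivAt (fun t : ℝ => (p + t • n) i) (n i) 0 := fun i => by
    simpa using ((hasDerivAt_id (0 : ℝ)).mul_const (n i)).const_add (p i)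
  have hc : HasDerivAt (fun t : ℝ => conf κ (p + t • n)) (dconf κ p n) 0 := by
    have h := ((((h0 0).pow 2).add ((h0 1).pow 2)).const_mul κ).const_add 4
    have h2 := (hasDerivAt_const (0 : ℝ) (4 : ℝ)).div h (by simpa using hp')
    refine h2.congr_deriv ?_
    simp only [dconf, conf, Pi.add_apply, Pi.smul_apply, zero_smul]
    simp
    field_simp
    ring
  have hb : ∀ v : Fin 3 → ℝ, HasDerivAt (fun t : ℝ => conf κ (p + t • n) * τ *
      ((p + t • n) 1 * v 0 - (p + t • n) 0 * v 1) + v 2)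
      (dconf κ p n * τ * (p 1 * v 0 - p 0 * v 1) + conf κ p * τ * (n 1 * v 0 - n 0 * v 1)) 0 := by
    intro v
    refine (((hc.mul_const τ).mul
      (((h0 1).mul_const (v 0)).sub ((h0 0).mul_const (v 1)))).add_const (v 2)).congr_deriv ?_
    simp
  have hm := ((hc.pow 2).mul_const (v 0 * w 0 + v 1 * w 1)).add ((hb v).mul (hb w))
  refine hm.deriv.trans ?_
  simp [dmetric]
  ring

theorem christoffel_eq {κ τ : ℝ} {p : Fin 3 → ℝ} (hp : p ∈ model κ) (v w n : Fin 3 → ℝ) :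
    christoffel κ τ p v w n =
      (dmetric κ τ p w n v + dmetric κ τ p v n w - dmetric κ τ p v w n) / 2 := by
  simp only [christoffel, fderiv_metric hp]

theorem rotation_zero (p : Fin 3 → ℝ) : rotation 0 p = p := by
  ext i; fin_cases i <;> simp [rotation]

section rotation

variable (κ τ θ : ℝ) (p v w n : Fin 3 → ℝ)

theorem rotation_dot :
    rotation θ v 0 * rotation θ w 0 + rotation θ v 1 * rotation θ w 1 =
      v 0 * w 0 + v 1 * w 1 := by
  simp only [rotation, Matrix.cons_val_zero, Matrix.cons_val_one]
  linear_combination (v 0 * w 0 + v 1 * w 1) * Real.sin_sq_add_cos_sq θ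

theorem rotation_cross :
    rotation θ p 1 * rotation θ v 0 - rotation θ p 0 * rotation θ v 1 =
      p 1 * v 0 - p 0 * v 1 := by
  simp only [rotation, Matrix.cons_val_zero, Matrix.cons_val_one]
  linear_combination (p 1 * v 0 - p 0 * v 1) * Real.sin_sq_add_cos_sq θ

theorem rotation_two : rotation θ v 2 = v 2 := rfl

theorem conf_rotation : conf κ (rotation θ p) = conf κ p := by
  have := rotation_dot θ p p
  simp only [← sq] at this
  simp only [conf, this]

theorem metric_rotation :
    metric κ τ (rotation θ p) (rotation θ v) (rotation θ w) = metric κ τ p v w := by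
  simp only [metric, conf_rotation, rotation_dot, rotation_cross, rotation_two]

theorem dmetric_rotation :
    dmetric κ τ (rotation θ p) (rotation θ v) (rotation θ w) (rotation θ n) =
      dmetric κ τ p v w n := by
  simp only [dmetric, dconf, conf_rotation, rotation_dot, rotation_cross, rotation_two]

theorem rotation_mem_model : rotation θ p ∈ model κ ↔ p ∈ model κ := by
  have := rotation_dot θ p p
  simp only [← sq] at this
  simp only [model, Set.mem_ofPred_eq, this]

theorem christoffel_rotation {κ : ℝ} {p : Fin 3 → ℝ} (hp : p ∈ model κ) :
    christoffel κ τ (rotation θ p) (rotation θ v) (rotation θ w) (rotation θ n) =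
      (dmetric κ τ p w n v + dmetric κ τ p v n w - dmetric κ τ p v w n) / 2 := by
  rw [christoffel_eq ((rotation_mem_model κ θ p).2 hp)]
  simp only [dmetric_rotation]

end rotation

section derivatives

variable {a b c a' b' c' : ℝ → ℝ}

theorem du_rotation (ha : ∀ u, HasDerivAt a (a' u) u) (hb : ∀ u, HasDerivAt b (b' u) u)
    (hc : ∀ u, HasDerivAt c (c' u) u) :
    du (fun u θ => rotation θ ![a u, b u, c u]) =
      fun u θ => rotation θ ![a' u, b' u, c' u] := by
  funext u θ
  refine HasDerivAt.deriv (hasDerivAt_pi.2 fun i => ?_)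
  fin_cases i
  · exact ((ha u).mul_const (Real.cos θ)).sub ((hb u).mul_const (Real.sin θ))
  · exact ((ha u).mul_const (Real.sin θ)).add ((hb u).mul_const (Real.cos θ))
  · simpa [rotation] using hc u

theorem dv_rotation (a b c : ℝ → ℝ) :
    dv (fun u θ => rotation θ ![a u, b u, c u]) =
      fun u θ => rotation θ ![-b u, a u, 0] := by
  funext u θ
  refine HasDerivAt.deriv (hasDerivAt_pi.2 fun i => ?_)
  have hs := Real.hasDerivAt_sin θ
  have hc := Real.hasDerivAt_cos θ
  fin_cases i
  · refine ((hc.const_mul (a u)).sub (hs.const_mul (b u))).congr_deriv ?_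
    simp [rotation]; ring
  · refine ((hs.const_mul (a u)).add (hc.const_mul (b u))).congr_deriv ?_
    simp [rotation]; ring
  · simpa [rotation] using hasDerivAt_const θ (c u)

end derivatives

theorem du_rotationSurface {x z x' z' : ℝ → ℝ} (hx : ∀ u, HasDerivAt x (x' u) u)
    (hz : ∀ u, HasDerivAt z (z' u) u) :
    du (rotationSurface x z) = fun u θ => rotation θ ![x' u, 0, z' u] :=
  du_rotation hx (fun u => hasDerivAt_const u 0) hz

theorem dv_rotationSurface (x z : ℝ → ℝ) :
    dv (rotationSurface x z) = fun u θ => rotation θ ![0, x u, 0] := by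
  have h := dv_rotation x (fun _ => 0) z
  rw [neg_zero] at h
  exact h

/-- A normal vector at `(x, 0, z)` of the rotational surface whose profile has velocity
`(x', 0, z')` there. It is not normalized: its squared length is `(λ √(1 + τ² x²) x')² + z'²`. -/
def profileNormal (κ τ x x' z' : ℝ) : Fin 3 → ℝ :=
  ![-z' / lam κ x, τ * x * x', lam κ x * rad τ x ^ 2 * x']

theorem rad_sq (τ x : ℝ) : rad τ x ^ 2 = 1 + τ ^ 2 * x ^ 2 :=
  Real.sq_sqrt (by positivity)

theorem rad_pos (τ x : ℝ) : 0 < rad τ x := Real.sqrt_pos.2 (by positivity)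

theorem conf_profile (κ x z : ℝ) : conf κ ![x, 0, z] = lam κ x := by
  simp [conf, lam]

theorem profile_mem_model {κ x z : ℝ} (h : 0 < 4 + κ * x ^ 2) : ![x, 0, z] ∈ model κ := by
  simpa [model] using h

/-- The mean curvature of a rotational surface in terms of the first two derivatives of its profile,
with respect to the normal field that is `s` times `profileNormal` at the point considered. By
rotational symmetry the computation is carried out at rotation angle zero. -/
theorem meanCurvature_rotationSurface {κ τ : ℝ} {x z x' z' x'' z'' : ℝ → ℝ}
    (hx : ∀ u, HasDerivAt x (x' u) u) (hz : ∀ u, HasDerivAt z (z' u) u)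
    (hx' : ∀ u, HasDerivAt x' (x'' u) u) (hz' : ∀ u, HasDerivAt z' (z'' u) u)
    {η : ℝ → ℝ → Fin 3 → ℝ} {u θ s : ℝ} (hpos : 0 < x u) (hm : 0 < 4 + κ * x u ^ 2)
    {V : ℝ} (hV : V = (lam κ (x u) * rad τ (x u) * x' u) ^ 2 + z' u ^ 2) (hV0 : 0 < V)
    (hη : η u θ = rotation θ (s • profileNormal κ τ (x u) (x' u) (z' u))) :
    meanCurvature κ τ (rotationSurface x z) η u θ =
      s * (crv κ (x u) * z' u * V +
        lam κ (x u) * rad τ (x u) ^ 2 * (x' u * z'' u - z' u * x'' u) -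
        (-(κ / 2) * x u * lam κ (x u) ^ 2 * rad τ (x u) ^ 2 + lam κ (x u) * τ ^ 2 * x u) *
          x' u ^ 2 * z' u) / (2 * V) := by
  have hdudv : du (dv (rotationSurface x z)) = fun u θ => rotation θ ![0, x' u, 0] := by
    rw [dv_rotationSurface]
    exact du_rotation (fun u => hasDerivAt_const u 0) hx (fun u => hasDerivAt_const u 0)
  have hdudu : du (du (rotationSurface x z)) = fun u θ => rotation θ ![x'' u, 0, z'' u] := by
    rw [du_rotationSurface hx hz]
    exact du_rotation hx' (fun u => hasDerivAt_const u 0) hz'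
  have hdvdv : dv (dv (rotationSurface x z)) = fun u θ => rotation θ ![-x u, 0, 0] := by
    rw [dv_rotationSurface]
    exact dv_rotation (fun _ => 0) x (fun _ => 0)
  have hM : ![x u, 0, z u] ∈ model κ := profile_mem_model hm
  simp only [meanCurvature, fundE, fundF, fundG, secondUU, secondUV, secondVV, hdudv, hdudu, hdvdv]
  simp only [du_rotationSurface hx hz, dv_rotationSurface, hη]
  simp only [rotationSurface, metric_rotation, christoffel_rotation _ _ _ _ _ hM]
  simp only [dmetric, dconf, metric, conf_profile, profileNormal]
  have hl : 0 < lam κ (x u) := div_pos (by norm_num) hm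
  have hlm : lam κ (x u) * (4 + κ * x u ^ 2) = 4 := div_mul_cancel₀ _ hm.ne'
  have hr := rad_sq τ (x u)
  generalize lam κ (x u) = l at *
  simp only [mul_pow, hr] at hV ⊢
  simp [crv]
  -- eliminate `κ` in favour of the conformal factor, so that the identity becomes rational
  have hk : κ = (4 / l - 4) / x u ^ 2 := by
    field_simp
    linear_combination hlm
  clear hlm hη hdudv hdudu hdvdv hM hm hr hx hz hx' hz'
  generalize x u = X at *
  generalize x' u = X₁ at *
  generalize z' u = Z₁ at *
  generalize x'' u = X₂ at *
  generalize z'' u = Z₂ at *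
  have hden : (l ^ 2 * (X₁ * X₁) + Z₁ * Z₁) * (l ^ 2 * (X * X) +
      l * τ * (X * X) * (l * τ * (X * X))) - (Z₁ * (l * τ * (X * X))) ^ 2 =
      l ^ 2 * X ^ 2 * V := by rw [hV]; ring
  rw [hden, div_eq_div_iff (by positivity) (by positivity), hk]
  field_simp
  rw [hV]
  ring

theorem lam_pos {κ x : ℝ} (hm : 0 < 4 + κ * x ^ 2) : 0 < lam κ x := div_pos (by norm_num) hm

theorem crv_pos {κ x : ℝ} (hκ : κ ≤ 0) (hx : 0 < x) : 0 < crv κ x :=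
  div_pos (by nlinarith [mul_nonneg (neg_nonneg.2 hκ) (sq_nonneg x)]) (by positivity)

theorem hasDerivAt_lam {κ x : ℝ} (hm : 0 < 4 + κ * x ^ 2) :
    HasDerivAt (lam κ) (-(κ / 2) * x * lam κ x ^ 2) x := by
  have h := ((hasDerivAt_pow 2 x).const_mul κ).const_add 4
  refine ((hasDerivAt_const x (4 : ℝ)).div h hm.ne').congr_deriv ?_
  simp only [lam]
  field_simp
  ring

theorem hasDerivAt_rad (τ x : ℝ) : HasDerivAt (rad τ) (τ ^ 2 * x / rad τ x) x := by
  have h := ((hasDerivAt_pow 2 x).const_mul (τ ^ 2)).const_add 1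
  refine (h.sqrt (by positivity)).congr_deriv ?_
  have := rad_pos τ x
  simp only [rad] at this ⊢
  field_simp
  norm_num

/-- The mean curvature of a rotational surface in terms of the vector `(p, q)`, where
`p = λ √(1 + τ² x²) x'` and `q = z'`: if `s = 1 / W` with `W² = p² + q²`, the formula reads
`2 H W³ = c q W² + √(1 + τ² x²) (p q' - q p')` with `c = crv κ x`, so that `p q' - q p'` measures
the rotation speed of `(p, q)`. -/
theorem meanCurvature_rotationSurface_frame {κ τ : ℝ} {x z x' z' x'' z'' : ℝ → ℝ}
    (hx : ∀ u, HasDerivAt x (x' u) u) (hz : ∀ u, HasDerivAt z (z' u) u)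
    (hx' : ∀ u, HasDerivAt x' (x'' u) u) (hz' : ∀ u, HasDerivAt z' (z'' u) u)
    {η : ℝ → ℝ → Fin 3 → ℝ} {u θ s : ℝ} (hpos : 0 < x u) (hm : 0 < 4 + κ * x u ^ 2)
    {V : ℝ} (hV : V = (lam κ (x u) * rad τ (x u) * x' u) ^ 2 + z' u ^ 2) (hV0 : 0 < V)
    (hη : η u θ = rotation θ (s • profileNormal κ τ (x u) (x' u) (z' u))) {p' : ℝ}
    (hp : HasDerivAt (fun t => lam κ (x t) * rad τ (x t) * x' t) p' u) :
    meanCurvature κ τ (rotationSurface x z) η u θ =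
      s * (crv κ (x u) * z' u * V +
        rad τ (x u) * (lam κ (x u) * rad τ (x u) * x' u * z'' u - z' u * p')) / (2 * V) := by
  rw [meanCurvature_rotationSurface hx hz hx' hz' hpos hm hV hV0 hη]
  have h := (((hasDerivAt_lam hm).comp u (hx u)).mul
    ((hasDerivAt_rad τ (x u)).comp u (hx u))).mul (hx' u)
  rw [hp.unique h]
  have hr := rad_pos τ (x u)
  congr 2
  simp only [Function.comp, Pi.mul_apply]
  field_simp
  ring

/-! ### The first-order system of a rotational torus -/

/-- The first-order system satisfied by the profile `(x, 0, z)` of a rotational surface whose mean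
curvature is `k |ν|`, where `ν` is the angle function. The unit vector `(ω, σ)` is the direction of
the profile, `ω = λ √(1 + τ² x²) x' / W` and `σ = z' / W`, for the speed
`W = √((λ √(1 + τ² x²) x')² + z'²)`; the angle function is then `ν = ω / √(1 + τ² x²)`. -/
structure ProfileCurve (κ τ : ℝ) (k : ℝ → ℝ) (x z σ ω W : ℝ → ℝ) : Prop where
  pos : ∀ u, 0 < x u
  mem : ∀ u, 0 < 4 + κ * x u ^ 2
  speed_pos : ∀ u, 0 < W u
  unit : ∀ u, σ u ^ 2 + ω u ^ 2 = 1
  deriv_x : ∀ u, HasDerivAt x (W u * ω u / (lam κ (x u) * rad τ (x u))) u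
  deriv_z : ∀ u, HasDerivAt z (W u * σ u) u
  deriv_sin : ∀ u, HasDerivAt σ
    (W u / rad τ (x u) * ω u * (2 * k (|ω u| / rad τ (x u)) - crv κ (x u) * σ u)) u
  deriv_cos : ∀ u, HasDerivAt ω
    (-(W u / rad τ (x u) * σ u * (2 * k (|ω u| / rad τ (x u)) - crv κ (x u) * σ u))) u

/-- A unit normal of a rotational surface at rotation angle zero is the multiple of `profileNormal`
by an explicit factor `s` with `s² V = 1`. -/
theorem eq_smul_profileNormal {κ τ x x' z' : ℝ} {n : Fin 3 → ℝ} (hx : 0 < x)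
    (hm : 0 < 4 + κ * x ^ 2) (z : ℝ) {V : ℝ}
    (hV : V = (lam κ x * rad τ x * x') ^ 2 + z' ^ 2) (hV0 : 0 < V)
    (h1 : metric κ τ ![x, 0, z] n n = 1) (h2 : metric κ τ ![x, 0, z] n ![x', 0, z'] = 0)
    (h3 : metric κ τ ![x, 0, z] n ![0, x, 0] = 0) {s : ℝ}
    (hs : s = (lam κ x * rad τ x ^ 2 * x' * (n 2 - lam κ x * τ * x * n 1) -
      lam κ x * n 0 * z') / V) :
    n = s • profileNormal κ τ x x' z' ∧ s ^ 2 * V = 1 ∧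
      metric κ τ ![x, 0, z] n xi = s * lam κ x * x' := by
  have hl := lam_pos hm
  have hr := rad_sq τ x
  simp only [metric, conf_profile, xi] at h1 h2 h3 ⊢
  simp only [mul_pow, hr] at hV hs
  simp [profileNormal, hr] at h1 h2 h3 ⊢
  generalize lam κ x = l at *
  obtain ⟨A, hA⟩ : ∃ A, A = n 2 - l * τ * x * n 1 := ⟨_, rfl⟩
  have e3 : l * n 1 = τ * x * A := by
    have : l * x ≠ 0 := by positivity
    apply mul_left_cancel₀ this
    rw [hA]
    linear_combination h3
  have e2 : l ^ 2 * n 0 * x' = -(A * z') := by rw [hA]; linear_combination h2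
  have e1 : l ^ 2 * (n 0 * n 0 + n 1 * n 1) + A ^ 2 = 1 := by rw [hA]; linear_combination h1
  rw [← hA] at hs
  have eA : A = s * l * x' := by
    rw [hs]
    field_simp
    rw [hV]
    linear_combination z' * e2
  have e0 : l * n 0 = -(s * z') := by
    rw [hs]
    field_simp
    rw [hV]
    linear_combination (1 + τ ^ 2 * x ^ 2) * x' * e2
  have en1 : n 1 = s * (τ * x * x') := by
    apply mul_left_cancel₀ hl.ne'
    rw [e3, eA]; ring
  have en0 : n 0 = s * (-z' / l) := by
    field_simp
    linear_combination e0
  refine ⟨?_, ?_, ?_⟩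
  · ext i
    fin_cases i
    · simpa using en0
    · simpa using en1
    · simp
      have : n 2 = A + l * τ * x * n 1 := by rw [hA]; ring
      rw [this, eA, en1]; ring
  · rw [hV]
    linear_combination (s * z' - l * n 0) * e0 -
      (1 + τ ^ 2 * x ^ 2) * (s * l * x' + A) * eA - (τ * x * A + l * n 1) * e3 + e1
  · rw [← eA, hA]; ring

/-- The derivative of the second coordinate `ε Z / W` of a normalized vector `ε (P, Z) / W`
reparametrized by `u ↦ ε u`, when the rotation speed `P Z' - Z P'` is prescribed. -/
theorem deriv_normalized_snd {ε P P' Z Z' W r c k : ℝ} (hr : 0 < r) (hW : 0 < W) (hε : ε ^ 2 = 1)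
    (hV : W ^ 2 = P ^ 2 + Z ^ 2) (h : r * (P * Z' - Z * P') = (P ^ 2 + Z ^ 2) *
      (2 * ε * W * k - c * Z)) :
    (ε * (ε * Z') * W - ε * Z * (ε * ((P * P' + Z * Z') / W))) / W ^ 2 =
      W / r * (ε * P / W) * (2 * k - c * (ε * Z / W)) := by
  field_simp
  rw [← hV] at h
  apply mul_left_cancel₀ (pow_ne_zero 2 hW.ne')
  linear_combination (ε ^ 2 * P * W ^ 2) * h + (r * ε ^ 2 * Z' * W ^ 2) * hV +
    (ε * 2 * k * P * W ^ 5) * hε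

/-- The analogue of `deriv_normalized_snd` for the first coordinate. -/
theorem deriv_normalized_fst {ε P P' Z Z' W r c k : ℝ} (hr : 0 < r) (hW : 0 < W) (hε : ε ^ 2 = 1)
    (hV : W ^ 2 = P ^ 2 + Z ^ 2) (h : r * (P * Z' - Z * P') = (P ^ 2 + Z ^ 2) *
      (2 * ε * W * k - c * Z)) :
    (ε * (ε * P') * W - ε * P * (ε * ((P * P' + Z * Z') / W))) / W ^ 2 =
      -(W / r * (ε * Z / W) * (2 * k - c * (ε * Z / W))) := by
  field_simp
  rw [← hV] at h
  linear_combination (-ε ^ 2 * Z) * h + (ε ^ 2 * r * P') * hV - (2 * ε * Z * W ^ 3 * k) * hε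

/-- The profile of a rotational `𝔥`-torus solves the system `ProfileCurve`. The unit normal is
`ε ∈ {1, -1}` times the one of the profile, and traversing the profile by `u ↦ ε u` reduces to
`ε = 1`. -/
theorem exists_profileCurve_of_isRotationalHTorus {κ τ : ℝ} {h : ℝ → ℝ} {T : ℝ} {x z : ℝ → ℝ}
    (heven : ∀ y ∈ Set.Icc (-1 : ℝ) 1, h (-y) = h y) (H : IsRotationalHTorus κ τ h T x z) :
    ∃ x z σ ω W : ℝ → ℝ, ProfileCurve κ τ h x z σ ω W ∧ 0 < T ∧ Function.Periodic z T ∧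
      Function.Periodic σ T := by
  obtain ⟨hpos, ⟨hI, η, hη, hH⟩⟩ := H
  have hslice : ContDiff ℝ 2 (fun u => rotationSurface x z u 0) :=
    hI.contDiff.comp (contDiff_id.prodMk contDiff_const)
  have hxC : ContDiff ℝ 2 x := by
    simpa [rotationSurface, rotation] using contDiff_pi.1 hslice 0
  have hzC : ContDiff ℝ 2 z := by
    simpa [rotationSurface, rotation] using contDiff_pi.1 hslice 2
  have hd : ∀ f : ℝ → ℝ, ContDiff ℝ 2 f → (∀ u, HasDerivAt f (deriv f u) u) ∧
      (∀ u, HasDerivAt (deriv f) (deriv (deriv f) u) u) := fun f hf =>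
    ⟨fun u => (hf.differentiable (by norm_num)).differentiableAt.hasDerivAt,
      fun u => (((contDiff_succ_iff_deriv (n := 1)).1
        (by simpa [one_add_one_eq_two] using hf)).2.2.differentiable (by norm_num)).differentiableAt.hasDerivAt⟩
  obtain ⟨hx, hx'⟩ := hd x hxC
  obtain ⟨hz, hz'⟩ := hd z hzC
  have hm : ∀ u, 0 < 4 + κ * x u ^ 2 := fun u => by
    have := hI.mem_model u 0
    rw [rotationSurface, rotation_zero] at this
    simpa [model] using this
  have hper : ∀ u, x (u + T) = x u ∧ z (u + T) = z u := fun u => by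
    have := hI.periodic_left u 0
    rw [rotationSurface, rotationSurface, rotation_zero, rotation_zero] at this
    exact ⟨by simpa using congrFun this 0, by simpa using congrFun this 2⟩
  have hper' : ∀ f : ℝ → ℝ, (∀ u, f (u + T) = f u) → ∀ u, deriv f (u + T) = deriv f u := by
    intro f hf u
    rw [← deriv_comp_add_const]
    simp only [hf]
  have hreg : ∀ u, deriv x u ≠ 0 ∨ deriv z u ≠ 0 := by
    intro u
    by_contra! hc
    have := (hI.immersion u 0).ne_zero 0
    apply this
    rw [du_rotationSurface hx hz]
    simp only [rotation_zero, Matrix.cons_val_zero, hc.1, hc.2]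
    ext i; fin_cases i <;> rfl
  set p : ℝ → ℝ := fun u => lam κ (x u) * rad τ (x u) * deriv x u with hp
  set V : ℝ → ℝ := fun u => p u ^ 2 + deriv z u ^ 2 with hV
  have hfac : ∀ u, 0 < lam κ (x u) * rad τ (x u) := fun u =>
    mul_pos (lam_pos (hm u)) (rad_pos _ _)
  have hVpos : ∀ u, 0 < V u := by
    intro u
    rcases hreg u with h0 | h0
    · have : p u ≠ 0 := mul_ne_zero (hfac u).ne' h0
      positivity
    · positivity
  have hcx : Continuous x := hxC.continuous
  have hcx' : Continuous (deriv x) := continuous_iff_continuousAt.2 fun u => (hx' u).continuousAt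
  have hcz' : Continuous (deriv z) := continuous_iff_continuousAt.2 fun u => (hz' u).continuousAt
  have hdlam : ∀ u, HasDerivAt (fun t => lam κ (x t)) _ u := fun u =>
    (hasDerivAt_lam (hm u)).comp u (hx u)
  have hclam : Continuous fun t => lam κ (x t) :=
    continuous_iff_continuousAt.2 fun u => (hdlam u).continuousAt
  have hdrad : ∀ u, HasDerivAt (fun t => rad τ (x t)) _ u := fun u =>
    (hasDerivAt_rad τ (x u)).comp u (hx u)
  have hcrad : Continuous fun t => rad τ (x t) :=
    continuous_iff_continuousAt.2 fun u => (hdrad u).continuousAt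
  obtain ⟨p', hp'⟩ : ∃ p' : ℝ → ℝ, ∀ u, HasDerivAt p (p' u) u :=
    ⟨_, fun u => ((hdlam u).mul (hdrad u)).mul (hx' u)⟩
  have hcp : Continuous p := continuous_iff_continuousAt.2 fun u => (hp' u).continuousAt
  have hcV : Continuous V := (hcp.pow 2).add (hcz'.pow 2)
  have hcη : Continuous fun u => η u 0 := hη.continuous.comp (Continuous.prodMk_left 0)
  have hcn : ∀ i, Continuous fun u => η u 0 i := fun i => (continuous_pi_iff.1 hcη) i
  set s : ℝ → ℝ := fun u => (lam κ (x u) * rad τ (x u) ^ 2 * deriv x u *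
    (η u 0 2 - lam κ (x u) * τ * x u * η u 0 1) - lam κ (x u) * η u 0 0 * deriv z u) / V u with hs
  have hcs : Continuous s := by
    refine Continuous.div ?_ hcV fun u => (hVpos u).ne'
    have := hcn 0; have := hcn 1; have := hcn 2
    fun_prop
  have hN : ∀ u, η u 0 = s u • profileNormal κ τ (x u) (deriv x u) (deriv z u) ∧
      s u ^ 2 * V u = 1 ∧ angle κ τ (rotationSurface x z) η u 0 = s u * lam κ (x u) * deriv x u := by
    intro u
    have h1 := hη.unit u 0
    have h2 := hη.normal_left u 0
    have h3 := hη.normal_right u 0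
    simp only [du_rotationSurface hx hz, dv_rotationSurface, rotationSurface, rotation_zero]
      at h1 h2 h3
    have := eq_smul_profileNormal (hpos u) (hm u) (z u) (V := V u) rfl (hVpos u) h1 h2 h3
      (s := s u) rfl
    simpa only [angle, rotationSurface, rotation_zero] using this
  set W : ℝ → ℝ := fun u => √(V u) with hW
  have hWpos : ∀ u, 0 < W u := fun u => Real.sqrt_pos.2 (hVpos u)
  have hWsq : ∀ u, W u ^ 2 = V u := fun u => Real.sq_sqrt (hVpos u).le
  -- by continuity the unit normal lies on a constant side of the surface
  obtain ⟨ε, hε, hsε⟩ : ∃ ε : ℝ, ε ^ 2 = 1 ∧ ∀ u, s u * W u = ε := by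
    have hc : ContinuousOn (fun u => s u * W u) Set.univ :=
      (hcs.mul (Real.continuous_sqrt.comp hcV)).continuousOn
    have hsq : Set.EqOn ((fun u => s u * W u) ^ 2) 1 Set.univ := fun u _ => by
      simp only [Pi.pow_apply, mul_pow, hWsq, (hN u).2.1, Pi.one_apply]
    rcases isPreconnected_univ.eq_one_or_eq_neg_one_of_sq_eq hc hsq with h1 | h1
    · exact ⟨1, by norm_num, fun u => h1 (Set.mem_univ u)⟩
    · exact ⟨-1, by norm_num, fun u => h1 (Set.mem_univ u)⟩
  have habs : |ε| = 1 := by rw [← sq_eq_sq₀ (abs_nonneg _) zero_le_one, sq_abs, hε, one_pow]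
  have hle : ∀ u, |ε * p u / W u| ≤ 1 := fun u => by
    rw [abs_div, abs_mul, habs, one_mul, abs_of_pos (hWpos u), div_le_one (hWpos u)]
    refine abs_le_of_sq_le_sq ?_ (hWpos u).le
    rw [hWsq]
    exact le_add_of_nonneg_right (sq_nonneg _)
  have hr1 : ∀ u, 1 ≤ rad τ (x u) := fun u =>
    Real.one_le_sqrt.2 (le_add_of_nonneg_right (by positivity))
  have hcurv : ∀ u, rad τ (x u) * (p u * deriv (deriv z) u - deriv z u * p' u) =
      V u * (2 * ε * W u * h (|ε * p u / W u| / rad τ (x u)) - crv κ (x u) * deriv z u) := by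
    intro u
    have h1 := meanCurvature_rotationSurface_frame hx hz hx' hz' (hpos u) (hm u) (V := V u) rfl
      (hVpos u) (θ := 0) (by rw [rotation_zero]; exact (hN u).1) (hp' u)
    have hang : s u * lam κ (x u) * deriv x u = ε * p u / W u / rad τ (x u) := by
      have := hWpos u
      have := hr1 u
      rw [← hsε u, hp]
      field_simp
    rw [hH u 0, (hN u).2.2, hang] at h1
    have heven' : h (ε * p u / W u / rad τ (x u)) = h (|ε * p u / W u| / rad τ (x u)) := by
      have hq : |ε * p u / W u| / rad τ (x u) ∈ Set.Icc (-1 : ℝ) 1 :=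
        ⟨by linarith [div_nonneg (abs_nonneg (ε * p u / W u)) (zero_le_one.trans (hr1 u))],
          div_le_one_of_le₀ ((hle u).trans (hr1 u)) (zero_le_one.trans (hr1 u))⟩
      rcases abs_choice (ε * p u / W u) with h0 | h0
      · rw [h0]
      · rw [← heven _ hq, h0, neg_div, neg_neg]
    rw [heven'] at h1
    have hsW : s u = ε / W u := by rw [← hsε u, mul_div_cancel_right₀ _ (hWpos u).ne']
    rw [hsW, eq_div_iff (by have := hVpos u; positivity)] at h1
    have hw := hWpos u
    field_simp at h1
    linear_combination (-ε) * h1 - (crv κ (x u) * deriv z u * V u +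
      rad τ (x u) * (p u * deriv (deriv z) u - deriv z u * p' u)) * hε
  have hWd : ∀ u, HasDerivAt W ((p u * p' u + deriv z u * deriv (deriv z) u) / W u) u := by
    intro u
    refine ((((hp' u).pow 2).add ((hz' u).pow 2)).sqrt (hVpos u).ne').congr_deriv ?_
    have hw := hWpos u
    simp only [hW] at hw ⊢
    simp only [hV] at hw ⊢
    simp
    field_simp
  have hεd : ∀ (f : ℝ → ℝ) (f' : ℝ → ℝ), (∀ u, HasDerivAt f (f' u) u) →
      ∀ u, HasDerivAt (fun t => f (ε * t)) (ε * f' (ε * u)) u := fun f f' hf u => by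
    have := (hf (ε * u)).comp u ((hasDerivAt_id u).const_mul ε)
    refine this.congr_deriv ?_
    ring
  have hεper : ∀ f : ℝ → ℝ, Function.Periodic f T → Function.Periodic (fun t => f (ε * t)) T := by
    intro f hf u
    rcases sq_eq_one_iff.1 hε with h1 | h1
    · simp only [h1, one_mul, hf u]
    · simp only [h1, mul_add, neg_one_mul, hf.neg (-u)]
  refine ⟨fun u => x (ε * u), fun u => z (ε * u), fun u => ε * deriv z (ε * u) / W (ε * u),
    fun u => ε * p (ε * u) / W (ε * u), fun u => W (ε * u),
    ⟨fun u => hpos _, fun u => hm _, fun u => hWpos _, fun u => ?_, fun u => ?_, fun u => ?_,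
      fun u => ?_, fun u => ?_⟩, hI.pos_left, ?_, ?_⟩
  · have hw := hWpos (ε * u)
    field_simp
    rw [hε, hWsq, hV]
    ring
  · refine (hεd x _ hx u).congr_deriv ?_
    have hw := hWpos (ε * u)
    have := hfac (ε * u)
    rw [mul_div_cancel₀ _ hw.ne', eq_div_iff this.ne', hp]
    ring
  · refine (hεd z _ hz u).congr_deriv ?_
    rw [mul_div_cancel₀ _ (hWpos (ε * u)).ne']
  · have hw := hWpos (ε * u)
    refine (((hεd (deriv z) _ hz' u).const_mul ε).div (hεd W _ hWd u) hw.ne').congr_deriv ?_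
    exact deriv_normalized_snd (rad_pos τ (x (ε * u))) hw hε (hWsq (ε * u)) (hcurv (ε * u))
  · have hw := hWpos (ε * u)
    refine (((hεd p _ hp' u).const_mul ε).div (hεd W _ hWd u) hw.ne').congr_deriv ?_
    exact deriv_normalized_fst (rad_pos τ (x (ε * u))) hw hε (hWsq (ε * u)) (hcurv (ε * u))
  · exact hεper z fun u => (hper u).2
  · refine hεper (fun t => ε * deriv z t / W t) fun u => ?_
    simp only [hW, hV, hp, (hper u).1, hper' x (fun u => (hper u).1), hper' z fun u => (hper u).2]

open Set Filter Topology

/-! ### Zeros and inverses of real functions -/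

theorem pos_of_forall_ne_zero {f : ℝ → ℝ} (hf : Continuous f) {s : Set ℝ} (hs : IsPreconnected s)
    (hne : ∀ u ∈ s, f u ≠ 0) {c : ℝ} (hc : c ∈ s) (hpos : 0 < f c) : ∀ u ∈ s, 0 < f u := by
  intro u hu
  by_contra! h
  obtain ⟨t, ht, h0⟩ := hs.intermediate_value hu hc hf.continuousOn ⟨h, hpos.le⟩
  exact hne t ht h0

theorem exists_first_zero {f : ℝ → ℝ} (hf : Continuous f) {a b : ℝ} (hab : a ≤ b)
    (hb : f b = 0) : ∃ w ∈ Icc a b, f w = 0 ∧ ∀ u ∈ Ico a w, f u ≠ 0 := by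
  have hc : IsCompact (Icc a b ∩ f ⁻¹' {0}) :=
    isCompact_Icc.inter_right (isClosed_singleton.preimage hf)
  obtain ⟨w, hw, hmin⟩ := hc.exists_isLeast ⟨b, ⟨hab, le_rfl⟩, hb⟩
  exact ⟨w, hw.1, hw.2, fun u hu h0 => absurd (hmin ⟨⟨hu.1, hu.2.le.trans hw.1.2⟩, h0⟩)
    (not_le.2 hu.2)⟩

theorem exists_last_zero {f : ℝ → ℝ} (hf : Continuous f) {a b : ℝ} (hab : a ≤ b)
    (ha : f a = 0) : ∃ w ∈ Icc a b, f w = 0 ∧ ∀ u ∈ Ioc w b, f u ≠ 0 := by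
  have hc : IsCompact (Icc a b ∩ f ⁻¹' {0}) :=
    isCompact_Icc.inter_right (isClosed_singleton.preimage hf)
  obtain ⟨w, hw, hmax⟩ := hc.exists_isGreatest ⟨a, ⟨le_rfl, hab⟩, ha⟩
  exact ⟨w, hw.1, hw.2, fun u hu h0 => absurd (hmax ⟨⟨hw.1.1.trans hu.1.le, hu.2⟩, h0⟩)
    (not_le.2 hu.1)⟩

/-- A continuous strictly increasing function on a compact interval has an inverse on its image
that extends to a continuous function on the line. -/
theorem exists_continuous_rightInverse {f : ℝ → ℝ} {a b : ℝ} (hab : a ≤ b)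
    (hf : ContinuousOn f (Icc a b)) (hm : StrictMonoOn f (Icc a b)) :
    ∃ g : ℝ → ℝ, Continuous g ∧ ∀ y ∈ Icc (f a) (f b), g y ∈ Icc a b ∧ f (g y) = y := by
  have hmaps : MapsTo f (Icc a b) (Icc (f a) (f b)) := fun u hu =>
    ⟨hm.monotoneOn ⟨le_rfl, hab⟩ hu hu.1, hm.monotoneOn hu ⟨hab, le_rfl⟩ hu.2⟩
  have hab' : f a ≤ f b := hm.monotoneOn ⟨le_rfl, hab⟩ ⟨hab, le_rfl⟩ hab
  let e : Icc a b ≃o Icc (f a) (f b) := StrictMono.orderIsoOfSurjective (hmaps.restrict f _ _)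
    (fun u v huv => hm u.2 v.2 huv) (fun y => by
      obtain ⟨u, hu, h⟩ := intermediate_value_Icc hab hf y.2
      exact ⟨⟨u, hu⟩, Subtype.ext h⟩)
  refine ⟨fun y => e.symm (projIcc _ _ hab' y),
    continuous_subtype_val.comp (e.symm.continuous.comp continuous_projIcc), fun y hy => ?_⟩
  refine ⟨(e.symm _).2, ?_⟩
  have h : (e (e.symm (projIcc _ _ hab' y)) : ℝ) = y := by
    rw [e.apply_symm_apply, projIcc_of_mem hab' hy]
  exact h

/-! ### Nonexistence of periodic solutions -/

namespace ProfileCurve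

variable {κ τ : ℝ} {k x z σ ω W : ℝ → ℝ}

theorem continuous_sin (P : ProfileCurve κ τ k x z σ ω W) : Continuous σ :=
  continuous_iff_continuousAt.2 fun u => (P.deriv_sin u).continuousAt

theorem continuous_cos (P : ProfileCurve κ τ k x z σ ω W) : Continuous ω :=
  continuous_iff_continuousAt.2 fun u => (P.deriv_cos u).continuousAt

theorem continuous_z (P : ProfileCurve κ τ k x z σ ω W) : Continuous z :=
  continuous_iff_continuousAt.2 fun u => (P.deriv_z u).continuousAt

theorem continuous_x (P : ProfileCurve κ τ k x z σ ω W) : Continuous x :=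
  continuous_iff_continuousAt.2 fun u => (P.deriv_x u).continuousAt

theorem cos_div_rad_mem (P : ProfileCurve κ τ k x z σ ω W) (u y : ℝ) :
    |ω u| / rad τ y ∈ Icc (0 : ℝ) 1 := by
  have h1 : |ω u| ≤ 1 := abs_le_of_sq_le_sq (by nlinarith [P.unit u, sq_nonneg (σ u)]) zero_le_one
  have h2 : 1 ≤ rad τ y := Real.one_le_sqrt.2 (le_add_of_nonneg_right (by positivity))
  exact ⟨by positivity, div_le_one_of_le₀ (h1.trans h2) (zero_le_one.trans h2)⟩

/-- Traversing the profile backwards and reflecting it in a horizontal plane gives another solution;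
this exchanges the arcs moving away from the axis with those moving towards it. -/
theorem reverse (P : ProfileCurve κ τ k x z σ ω W) :
    ProfileCurve κ τ k (fun u => x (-u)) (fun u => -z (-u)) (fun u => σ (-u))
      (fun u => -ω (-u)) (fun u => W (-u)) where
  pos u := P.pos _
  mem u := P.mem _
  speed_pos u := P.speed_pos _
  unit u := by rw [neg_sq]; exact P.unit _
  deriv_x u := ((P.deriv_x (-u)).comp u (hasDerivAt_neg u)).congr_deriv (by ring)
  deriv_z u := ((P.deriv_z (-u)).comp u (hasDerivAt_neg u)).neg.congr_deriv (by ring)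
  deriv_sin u := ((P.deriv_sin (-u)).comp u (hasDerivAt_neg u)).congr_deriv (by rw [abs_neg]; ring)
  deriv_cos u := ((P.deriv_cos (-u)).comp u (hasDerivAt_neg u)).neg.congr_deriv
    (by rw [abs_neg]; ring)

/-- The vertical flux `λ x σ`, the conserved quantity of vertical translations up to the mean
curvature term, satisfies `(λ x σ)' = 2 H λ² x x'`. -/
theorem hasDerivAt_flux (P : ProfileCurve κ τ k x z σ ω W) (u : ℝ) :
    HasDerivAt (fun t => lam κ (x t) * x t * σ t)
      (2 * k (|ω u| / rad τ (x u)) * lam κ (x u) * x u * W u / rad τ (x u) * ω u) u := by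
  have h := ((((hasDerivAt_lam (P.mem u)).comp u (P.deriv_x u)).mul (P.deriv_x u)).mul
    (P.deriv_sin u))
  refine h.congr_deriv ?_
  have hx := P.pos u
  have hm := P.mem u
  have hr := rad_pos τ (x u)
  have hl : lam κ (x u) = 4 / (4 + κ * x u ^ 2) := rfl
  simp only [crv, Function.comp, Pi.mul_apply, hl]
  field_simp
  ring

theorem strictMonoOn_flux (P : ProfileCurve κ τ k x z σ ω W) (hk : ∀ y ∈ Icc (0 : ℝ) 1, 0 < k y)
    {a b : ℝ} (hω : ∀ u ∈ Ioo a b, 0 < ω u) :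
    StrictMonoOn (fun t => lam κ (x t) * x t * σ t) (Icc a b) := by
  refine strictMonoOn_of_deriv_pos (convex_Icc a b)
    (fun u _ => (P.hasDerivAt_flux u).continuousAt.continuousWithinAt) fun u hu => ?_
  rw [interior_Icc] at hu
  rw [(P.hasDerivAt_flux u).deriv]
  have := hω u hu
  have := P.pos u
  have := lam_pos (P.mem u)
  have := rad_pos τ (x u)
  have := P.speed_pos u
  have := hk _ (P.cos_div_rad_mem u (x u))
  positivity

theorem flux_pos (P : ProfileCurve κ τ k x z σ ω W) (u : ℝ) : 0 < lam κ (x u) * x u :=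
  mul_pos (lam_pos (P.mem u)) (P.pos u)

theorem flux_neg_iff (P : ProfileCurve κ τ k x z σ ω W) (u : ℝ) :
    lam κ (x u) * x u * σ u < 0 ↔ σ u < 0 :=
  ⟨fun h => neg_of_mul_neg_right h (P.flux_pos u).le, mul_neg_of_pos_of_neg (P.flux_pos u)⟩

theorem cos_eq_zero (P : ProfileCurve κ τ k x z σ ω W) {u : ℝ} (h : σ u = -1) : ω u = 0 := by
  have := P.unit u
  rw [h] at this
  simpa using this

theorem sin_eq_of_cos_eq_zero (P : ProfileCurve κ τ k x z σ ω W) {u : ℝ} (h : ω u = 0) :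
    σ u = 1 ∨ σ u = -1 := by
  have := P.unit u
  rw [h] at this
  exact sq_eq_one_iff.1 (by simpa using this)

/-- An arc that moves away from the axis and descends at some point started at a point where the
profile is vertical and descending, because the flux increases along it. -/
theorem exists_sin_eq_neg_one (P : ProfileCurve κ τ k x z σ ω W)
    (hk : ∀ y ∈ Icc (0 : ℝ) 1, 0 < k y) {a q : ℝ} (haq : a ≤ q) (ha : ω a = 0) (hq : 0 < ω q)
    (hσ : σ q ≤ 0) : ∃ e ∈ Ico a q, σ e = -1 := by
  obtain ⟨e, he, he0, hne⟩ := exists_last_zero P.continuous_cos haq ha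
  have heq : e < q := lt_of_le_of_ne he.2 fun h => by rw [h] at he0; exact hq.ne' he0
  have hpos := pos_of_forall_ne_zero P.continuous_cos isPreconnected_Ioc hne ⟨heq, le_rfl⟩ hq
  have hlt := P.strictMonoOn_flux hk (a := e) (b := q) (fun u hu => hpos u ⟨hu.1, hu.2.le⟩)
    ⟨le_rfl, heq.le⟩ ⟨heq.le, le_rfl⟩ heq
  have h0 : σ e < 0 := (P.flux_neg_iff e).1
    (hlt.trans_le (mul_nonpos_of_nonneg_of_nonpos (P.flux_pos q).le hσ))
  rcases P.sin_eq_of_cos_eq_zero he0 with h | h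
  · linarith
  · exact ⟨e, ⟨he.1, heq⟩, h⟩

/-- An arc that moves towards the axis and descends at some point ends at a point where the profile
is vertical and descending. -/
theorem exists_sin_eq_neg_one' (P : ProfileCurve κ τ k x z σ ω W)
    (hk : ∀ y ∈ Icc (0 : ℝ) 1, 0 < k y) {q b : ℝ} (hqb : q ≤ b) (hb : ω b = 0) (hq : ω q < 0)
    (hσ : σ q ≤ 0) : ∃ e ∈ Ioc q b, σ e = -1 := by
  obtain ⟨e, he, h⟩ := P.reverse.exists_sin_eq_neg_one hk (a := -b) (q := -q) (neg_le_neg hqb)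
    (by simpa using hb) (by simpa using hq) (by simpa using hσ)
  exact ⟨-e, ⟨by linarith [he.2], by linarith [he.1]⟩, h⟩

/-- Where the profile is vertical and descending, its distance to the axis has a strict local
minimum. -/
theorem eventually_sign_cos (P : ProfileCurve κ τ k x z σ ω W) (hκ : κ ≤ 0)
    (hk : ∀ y ∈ Icc (0 : ℝ) 1, 0 < k y) {v : ℝ} (hv : σ v = -1) :
    ∀ᶠ u in 𝓝 v, SignType.sign (ω u) = SignType.sign (u - v) := by
  refine eventually_nhdsWithin_sign_eq_of_deriv_pos ?_ (P.cos_eq_zero hv)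
  rw [(P.deriv_cos v).deriv, hv]
  have h1 := hk _ (P.cos_div_rad_mem v (x v))
  have h2 := crv_pos hκ (P.pos v)
  have h3 := div_pos (P.speed_pos v) (rad_pos τ (x v))
  have : 0 < W v / rad τ (x v) * (2 * k (|ω v| / rad τ (x v)) + crv κ (x v)) := by positivity
  linarith

/-- Along an arc that moves away from the axis, from a descending to an ascending vertical tangent,
the height increases strictly: when `k` is non-decreasing, the ascending part rises more than the
descending part drops. At points of the two parts with opposite values of `σ`, the outer one has
larger `√(1 + τ² x²)`, smaller `|ν|`, hence smaller `k |ν|`, and turns more slowly. -/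
theorem lt_of_sin_eq (P : ProfileCurve κ τ k x z σ ω W) (hκ : κ ≤ 0)
    (hk : ∀ y ∈ Icc (0 : ℝ) 1, 0 < k y) (hmono : MonotoneOn k (Icc 0 1)) {v w : ℝ} (hvw : v < w)
    (hω : ∀ u ∈ Ioo v w, 0 < ω u) (hv : σ v = -1) (hw : σ w = 1) : z v < z w := by
  obtain ⟨p, hp, hp0⟩ : ∃ p ∈ Ioo v w, σ p = 0 :=
    intermediate_value_Ioo hvw.le P.continuous_sin.continuousOn (by rw [hv, hw]; norm_num)
  have hflux := P.strictMonoOn_flux hk hω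
  have hneg : ∀ u ∈ Ico v p, σ u < 0 := fun u hu => by
    have := hflux ⟨hu.1, hu.2.le.trans hp.2.le⟩ ⟨hp.1.le, hp.2.le⟩ hu.2
    simp only [hp0, mul_zero] at this
    exact (P.flux_neg_iff u).1 this
  have hpos : ∀ u ∈ Ioc p w, 0 < σ u := fun u hu => by
    have := hflux ⟨hp.1.le, hp.2.le⟩ ⟨hp.1.le.trans hu.1.le, hu.2⟩ hu.1
    simp only [hp0, mul_zero] at this
    exact pos_of_mul_pos_right this (P.flux_pos u).le
  have hxm : StrictMonoOn x (Icc v w) := by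
    refine strictMonoOn_of_deriv_pos (convex_Icc v w) P.continuous_x.continuousOn fun u hu => ?_
    rw [interior_Icc] at hu
    rw [(P.deriv_x u).deriv]
    exact div_pos (mul_pos (P.speed_pos u) (hω u hu))
      (mul_pos (lam_pos (P.mem u)) (rad_pos _ _))
  have hrate : ∀ u ∈ Ioo v p, 0 < 2 * k (|ω u| / rad τ (x u)) - crv κ (x u) * σ u := fun u hu => by
    have h1 := hk _ (P.cos_div_rad_mem u (x u))
    have h2 := mul_pos_of_neg_of_neg (neg_neg_of_pos (crv_pos hκ (P.pos u))) (hneg u ⟨hu.1.le, hu.2⟩)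
    linarith
  have hσ' : ∀ u ∈ Ioo v p, 0 < W u / rad τ (x u) * ω u *
      (2 * k (|ω u| / rad τ (x u)) - crv κ (x u) * σ u) := fun u hu =>
    mul_pos (mul_pos (div_pos (P.speed_pos u) (rad_pos _ _)) (hω u ⟨hu.1, hu.2.trans hp.2⟩))
      (hrate u hu)
  have hσm : StrictMonoOn σ (Icc v p) := by
    refine strictMonoOn_of_deriv_pos (convex_Icc v p) P.continuous_sin.continuousOn fun u hu => ?_
    rw [interior_Icc] at hu
    rw [(P.deriv_sin u).deriv]
    exact hσ' u hu
  obtain ⟨E, hEc, hE⟩ := exists_continuous_rightInverse hp.1.le P.continuous_sin.continuousOn hσm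
  rw [hv, hp0] at hE
  have hEp : E 0 = p := hσm.injOn (hE 0 (by norm_num)).1 ⟨hp.1.le, le_rfl⟩
    (by rw [(hE 0 (by norm_num)).2, hp0])
  have hEv : E (-1) = v := hσm.injOn (hE (-1) (by norm_num)).1 ⟨le_rfl, hp.1.le⟩
    (by rw [(hE (-1) (by norm_num)).2, hv])
  -- `E (-σ u)` is the point of the descending part with slope opposite to that at `u`
  have hD : StrictMonoOn (fun u => z u - z (E (-σ u))) (Icc p w) := by
    refine strictMonoOn_of_deriv_pos (convex_Icc p w) (P.continuous_z.sub
      (P.continuous_z.comp (hEc.comp P.continuous_sin.neg))).continuousOn fun u hu => ?_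
    rw [interior_Icc] at hu
    have hωu := hω u ⟨hp.1.trans hu.1, hu.2⟩
    have hσu := hpos u ⟨hu.1, hu.2.le⟩
    have hσu1 : σ u < 1 := by nlinarith [P.unit u]
    obtain ⟨heI, he⟩ := hE (-σ u) ⟨by linarith, by linarith⟩
    set e := E (-σ u) with hedef
    have he1 : v < e := lt_of_le_of_ne heI.1 fun h => by rw [← h, hv] at he; linarith
    have he2 : e < p := lt_of_le_of_ne heI.2 fun h => by rw [h, hp0] at he; linarith
    have hωe := hω e ⟨he1, he2.trans hp.2⟩
    have hωeq : ω e = ω u := by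
      have h1 := P.unit e
      have h2 := P.unit u
      rw [he] at h1
      exact (sq_eq_sq₀ hωe.le hωu.le).1 (by linarith)
    have hσe' := hσ' e ⟨he1, he2⟩
    have hEd : HasDerivAt E _ (-σ u) := HasDerivAt.of_local_left_inverse hEc.continuousAt
      (P.deriv_sin e) hσe'.ne'
      (by filter_upwards [Icc_mem_nhds (a := -1) (b := 0) (show -1 < -σ u by linarith)
            (by linarith)] with y hy using (hE y hy).2)
    have hd : HasDerivAt (fun u => z u - z (E (-σ u))) _ u :=
      (P.deriv_z u).sub ((P.deriv_z e).comp u (hEd.comp u (P.deriv_sin u).neg))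
    rw [hd.deriv]
    have hxe : x e < x u := hxm ⟨heI.1, heI.2.trans hp.2.le⟩ ⟨hp.1.le.trans hu.1.le, hu.2.le⟩
      (he2.trans hu.1)
    have hrr : rad τ (x e) ≤ rad τ (x u) := Real.sqrt_le_sqrt (by
      have := P.pos e
      gcongr)
    have hre := rad_pos τ (x e)
    have hru := rad_pos τ (x u)
    have hkk : k (|ω u| / rad τ (x u)) ≤ k (|ω u| / rad τ (x e)) :=
      hmono (P.cos_div_rad_mem _ _) (P.cos_div_rad_mem _ _) (by gcongr)
    have hY := hrate e ⟨he1, he2⟩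
    have hcu := mul_pos (crv_pos hκ (P.pos u)) hσu
    have hce := mul_pos (crv_pos hκ (P.pos e)) hσu
    have hWe := P.speed_pos e
    have hWu := P.speed_pos u
    rw [hωeq, he] at hY hσe' ⊢
    set A := 2 * k (|ω u| / rad τ (x u)) - crv κ (x u) * σ u with hA
    set B := 2 * k (|ω u| / rad τ (x e)) - crv κ (x e) * -σ u with hB
    have hAB : A < B := by rw [hA, hB]; linarith
    have hkey : rad τ (x e) * A < rad τ (x u) * B := by nlinarith
    have : W u * σ u - W e * -σ u * ((W e / rad τ (x e) * ω u * B)⁻¹ *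
        -(W u / rad τ (x u) * ω u * A)) =
        W u * σ u * (rad τ (x u) * B - rad τ (x e) * A) / (rad τ (x u) * B) := by
      field_simp
    rw [this]
    have := sub_pos.2 hkey
    positivity
  have := hD ⟨le_rfl, hp.2.le⟩ ⟨hp.2.le, le_rfl⟩ hp.2
  simp only [hp0, hw, neg_zero, hEp, hEv, sub_self] at this
  linarith

/-- After a descending vertical tangent the profile moves away from the axis until it reaches an
ascending one. -/
theorem exists_sin_eq_one (P : ProfileCurve κ τ k x z σ ω W) (hκ : κ ≤ 0)
    (hk : ∀ y ∈ Icc (0 : ℝ) 1, 0 < k y) {v v' : ℝ} (hvv : v < v') (hv : σ v = -1)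
    (hv' : σ v' = -1) : ∃ w ∈ Ioo v v', σ w = 1 ∧ ∀ u ∈ Ioo v w, 0 < ω u := by
  have hright : ∀ᶠ u in 𝓝[>] v, 0 < ω u := by
    filter_upwards [(P.eventually_sign_cos hκ hk hv).filter_mono nhdsWithin_le_nhds,
      self_mem_nhdsWithin] with u hu huv
    rw [sign_pos (sub_pos.2 huv)] at hu
    exact sign_eq_one_iff.1 hu
  obtain ⟨d, hd, hdpos⟩ := (mem_nhdsGT_iff_exists_Ioo_subset' hvv).1 hright
  obtain ⟨c, hc1, hc2⟩ := exists_between (lt_min hd hvv)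
  have hcd := hc2.trans_le (min_le_left _ _)
  have hcv := hc2.trans_le (min_le_right _ _)
  obtain ⟨w, hw, hw0, hne⟩ := exists_first_zero P.continuous_cos hcv.le (P.cos_eq_zero hv')
  have hωc : 0 < ω c := hdpos ⟨hc1, hcd⟩
  have hcw : c < w := lt_of_le_of_ne hw.1 fun h => by rw [h] at hωc; exact hωc.ne' hw0
  have hcwpos := pos_of_forall_ne_zero P.continuous_cos isPreconnected_Ico hne ⟨le_rfl, hcw⟩ hωc
  have hpos : ∀ u ∈ Ioo v w, 0 < ω u := fun u hu => by
    rcases lt_or_ge u c with h | h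
    · exact hdpos ⟨hu.1, h.trans hcd⟩
    · exact hcwpos u ⟨h, hu.2⟩
  have hvw : v < w := hc1.trans hcw
  have hσw : σ w ≠ -1 := by
    intro h
    have h1 : ∀ᶠ u in 𝓝[<] w, ω u < 0 := by
      filter_upwards [(P.eventually_sign_cos hκ hk h).filter_mono nhdsWithin_le_nhds,
        self_mem_nhdsWithin] with u hu huv
      rw [sign_neg (sub_neg.2 huv)] at hu
      exact sign_eq_neg_one_iff.1 hu
    obtain ⟨u, hu1, hu2⟩ := (h1.and (Ioo_mem_nhdsLT hvw)).exists
    exact absurd (hpos u hu2) (not_lt.2 hu1.le)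
  refine ⟨w, ⟨hvw, lt_of_le_of_ne hw.2 fun h => hσw (h ▸ hv')⟩,
    (P.sin_eq_of_cos_eq_zero hw0).resolve_right hσw, hpos⟩

/-- In a periodic solution, every descending vertical tangent is followed by a higher one. Between
them the profile moves away from the axis to an ascending vertical tangent at `w`, ascends until
`w'`, and returns towards the axis; the first and last arcs have positive height gain by
`lt_of_sin_eq`. -/
theorem exists_higher (P : ProfileCurve κ τ k x z σ ω W) (hκ : κ ≤ 0)
    (hk : ∀ y ∈ Icc (0 : ℝ) 1, 0 < k y) (hmono : MonotoneOn k (Icc 0 1)) {T : ℝ} (hT : 0 < T)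
    (hσT : Function.Periodic σ T) {v : ℝ} (hv : σ v = -1) : ∃ v', σ v' = -1 ∧ z v < z v' := by
  obtain ⟨w, hw, hw1, hwpos⟩ := P.exists_sin_eq_one hκ hk (lt_add_of_pos_right v hT) hv
    (by rw [hσT, hv])
  have h1 := P.lt_of_sin_eq hκ hk hmono hw.1 hwpos hv hw1
  obtain ⟨v', hv', hv'0, hfirst⟩ := exists_first_zero (f := fun u => σ u + 1)
    (P.continuous_sin.add continuous_const) hw.2.le (by simp only [hσT v, hv]; norm_num)
  have hv'1 : σ v' = -1 := by linarith
  replace hfirst : ∀ u ∈ Ico w v', σ u ≠ -1 := fun u hu h => hfirst u hu (by rw [h]; norm_num)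
  have hwv' : w < v' := lt_of_le_of_ne hv'.1 fun h => by rw [← h, hw1] at hv'1; norm_num at hv'1
  -- the arc ending at `v'`, traversed backwards
  obtain ⟨w'', hw'', hw''1, hw''pos⟩ := P.reverse.exists_sin_eq_one hκ hk (v := -v') (v' := -(v' - T))
    (by linarith) (by simpa using hv'1) (by simpa [hσT.sub_eq] using hv'1)
  have h2 := P.reverse.lt_of_sin_eq hκ hk hmono hw''.1 hw''pos (by simpa using hv'1) hw''1
  obtain ⟨w', rfl⟩ : ∃ w', w'' = -w' := ⟨-w'', (neg_neg _).symm⟩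
  simp only [neg_neg] at h2 hw''1
  have hw'v' : w' < v' := by linarith [hw''.1]
  have hωw : ω w = 0 := by
    have := P.unit w
    rw [hw1] at this
    simpa using this
  have hωw' : ω w' = 0 := by
    have := P.unit w'
    rw [hw''1] at this
    simpa using this
  have hww' : w ≤ w' := by
    by_contra! h
    have := hw''pos (-w) ⟨by linarith, by linarith⟩
    simp [hωw] at this
  have hσpos : ∀ q ∈ Icc w w', 0 < σ q := by
    intro q hq
    by_contra! h
    rcases lt_trichotomy (ω q) 0 with h0 | h0 | h0
    · obtain ⟨e, he, he1⟩ := P.exists_sin_eq_neg_one' hk hq.2 hωw' h0 h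
      exact hfirst e ⟨hq.1.trans he.1.le, he.2.trans_lt hw'v'⟩ he1
    · rcases P.sin_eq_of_cos_eq_zero h0 with h3 | h3
      · linarith
      · exact hfirst q ⟨hq.1, hq.2.trans_lt hw'v'⟩ h3
    · obtain ⟨e, he, he1⟩ := P.exists_sin_eq_neg_one hk hq.1 hωw h0 h
      exact hfirst e ⟨he.1, he.2.trans (hq.2.trans_lt hw'v')⟩ he1
  have h3 : z w ≤ z w' := by
    refine monotoneOn_of_deriv_nonneg (convex_Icc w w') P.continuous_z.continuousOn
      (fun u _ => (P.deriv_z u).differentiableAt.differentiableWithinAt) (fun u hu => ?_)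
      ⟨le_rfl, hww'⟩ ⟨hww', le_rfl⟩ hww'
    rw [(P.deriv_z u).deriv]
    exact (mul_pos (P.speed_pos u) (hσpos u (interior_subset hu))).le
  exact ⟨v', hv'1, by linarith⟩

theorem exists_sin_eq_neg_one_of_periodic (P : ProfileCurve κ τ k x z σ ω W)
    (hk : ∀ y ∈ Icc (0 : ℝ) 1, 0 < k y) {T : ℝ} (hT : 0 < T) (hσT : Function.Periodic σ T)
    {q : ℝ} (hq : σ q = 0) (hωq : 0 < ω q) : ∃ v, σ v = -1 := by
  by_cases hz : ∃ a ∈ Icc (q - T) q, ω a = 0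
  · obtain ⟨a, ha, ha0⟩ := hz
    obtain ⟨e, -, he⟩ := P.exists_sin_eq_neg_one hk ha.2 ha0 hωq hq.le
    exact ⟨e, he⟩
  · push Not at hz
    have hqT : q - T < q := by linarith
    have hpos := pos_of_forall_ne_zero P.continuous_cos isPreconnected_Icc hz ⟨hqT.le, le_rfl⟩ hωq
    have := P.strictMonoOn_flux hk (fun u hu => hpos u ⟨hu.1.le, hu.2.le⟩) ⟨le_rfl, hqT.le⟩
      ⟨hqT.le, le_rfl⟩ hqT
    simp [hσT.sub_eq, hq] at this

/-- There are no periodic solutions: the highest descending vertical tangent contradicts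
`exists_higher`. -/
theorem not_periodic (P : ProfileCurve κ τ k x z σ ω W) (hκ : κ ≤ 0)
    (hk : ∀ y ∈ Icc (0 : ℝ) 1, 0 < k y) (hmono : MonotoneOn k (Icc 0 1)) {T : ℝ} (hT : 0 < T)
    (hzT : Function.Periodic z T) (hσT : Function.Periodic σ T) : False := by
  obtain ⟨q, -, hq⟩ := exists_hasDerivAt_eq_zero hT P.continuous_z.continuousOn
    (by have := hzT 0; rw [zero_add] at this; exact this.symm) (fun u _ => P.deriv_z u)
  replace hq : σ q = 0 := (mul_eq_zero.1 hq).resolve_left (P.speed_pos q).ne'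
  have hex : ∃ v, σ v = -1 := by
    rcases lt_trichotomy (ω q) 0 with h | h | h
    · obtain ⟨v, hv⟩ := P.reverse.exists_sin_eq_neg_one_of_periodic hk hT
        (fun u => by rw [neg_add, ← sub_eq_add_neg, hσT.sub_eq]) (q := -q) (by simpa using hq)
        (by simpa using h)
      exact ⟨-v, hv⟩
    · rcases P.sin_eq_of_cos_eq_zero h with h1 | h1 <;> rw [hq] at h1 <;> norm_num at h1
    · exact P.exists_sin_eq_neg_one_of_periodic hk hT hσT hq h
  have hK : IsCompact (Icc 0 T ∩ σ ⁻¹' {-1}) :=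
    isCompact_Icc.inter_right (isClosed_singleton.preimage P.continuous_sin)
  have hne : (Icc 0 T ∩ σ ⁻¹' {-1}).Nonempty := by
    obtain ⟨v, hv⟩ := hex
    obtain ⟨y, hy, h⟩ := hσT.exists_mem_Ico₀ hT v
    exact ⟨y, ⟨hy.1, hy.2.le⟩, by rw [mem_preimage, ← h, hv]; rfl⟩
  obtain ⟨v, hv, hmax⟩ := hK.exists_isMaxOn hne P.continuous_z.continuousOn
  obtain ⟨v', hv', hlt⟩ := P.exists_higher hκ hk hmono hT hσT hv.2
  obtain ⟨n, hn⟩ : ∃ n : ℤ, v' - n * T ∈ Ico 0 T := by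
    obtain ⟨n, hn, -⟩ := existsUnique_sub_zsmul_mem_Ico hT v' 0
    exact ⟨n, by simpa using hn⟩
  have h1 : σ (v' - n * T) = -1 := by rw [hσT.sub_int_mul_eq, hv']
  have h2 := hmax ⟨⟨hn.1, hn.2.le⟩, h1⟩
  rw [mem_ofPred_eq, hzT.sub_int_mul_eq] at h2
  exact absurd hlt (not_lt.2 h2)

end ProfileCurve

theorem not_isRotationalHTorus {κ τ : ℝ} (hκ : κ ≤ 0) {h : ℝ → ℝ} (hC : PrescribedClass κ h)
    (hanti : AntitoneOn h (Icc (-1) 0)) (T : ℝ) (x z : ℝ → ℝ) :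
    ¬ IsRotationalHTorus κ τ h T x z := by
  intro H
  obtain ⟨x, z, σ, ω, W, P, hT, hz, hσ⟩ := exists_profileCurve_of_isRotationalHTorus hC.even H
  refine P.not_periodic hκ (fun y hy => hC.pos y ⟨by linarith [hy.1], hy.2⟩) ?_ hT hz hσ
  intro a ha b hb hab
  rw [← hC.even a ⟨by linarith [ha.1], ha.2⟩, ← hC.even b ⟨by linarith [hb.1], hb.2⟩]
  exact hanti ⟨by linarith [hb.2], by linarith [hb.1]⟩ ⟨by linarith [ha.2], by linarith [ha.1]⟩
    (by linarith)

/-! ### The profile equation parametrized by the direction angle -/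

/-- Conditions on a scale `ℓ` and on `f`, the doubled mean curvature as a function of the squared
angle function, which make the profile equation regular on the annulus `3ℓ/2 ≤ x ≤ 7ℓ/2`: the
annulus lies well inside the model, and `f` exceeds the curvature `crv κ x ≤ 1 / ℓ` of its
circles. -/
structure Admissible (κ ℓ : ℝ) (f : ℝ → ℝ) : Prop where
  nonpos : κ ≤ 0
  pos : 0 < ℓ
  small : -κ * ℓ ^ 2 ≤ 1 / 50
  contDiff : ContDiff ℝ 1 f
  lower : ∀ y, 3 / ℓ ≤ f y

/-- The square of the angle function at distance `x` from the axis, where the profile makes the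
angle of sine `w` with the horizontal. -/
def angleSq (τ w x : ℝ) : ℝ := (1 - w ^ 2) / (1 + τ ^ 2 * x ^ 2)

/-- The quantity `2 H - c σ`, proportional to the speed at which the direction of the profile
rotates, at distance `x` from the axis and for `σ = w`. -/
def turning (κ τ : ℝ) (f : ℝ → ℝ) (w x : ℝ) : ℝ := f (angleSq τ w x) - crv κ x * w

/-- The derivative `dx/dw` of the distance to the axis with respect to the sine `w` of the direction
angle of the profile. -/
def radialRate (κ τ : ℝ) (f : ℝ → ℝ) (w x : ℝ) : ℝ := (4 + κ * x ^ 2) / 4 / turning κ τ f w x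

/-- The speed of the profile parametrized by its direction angle `φ`; the height then satisfies
`dz/dφ = sin φ * verticalRate`. -/
def verticalRate (κ τ : ℝ) (f : ℝ → ℝ) (w x : ℝ) : ℝ := rad τ x / turning κ τ f w x

namespace Admissible

variable {κ τ ℓ : ℝ} {f : ℝ → ℝ} {w x : ℝ}

theorem pos_of_mem (A : Admissible κ ℓ f) (hx : x ∈ Icc (3 * ℓ / 2) (7 * ℓ / 2)) : 0 < x := by
  linarith [A.pos, hx.1]

theorem conf_mem (A : Admissible κ ℓ f) (hx : x ∈ Icc (3 * ℓ / 2) (7 * ℓ / 2)) :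
    (4 + κ * x ^ 2) / 4 ∈ Icc (9 / 10) 1 := by
  have h0 := A.pos_of_mem hx
  have h1 : x ^ 2 ≤ (7 * ℓ / 2) ^ 2 := pow_le_pow_left₀ h0.le hx.2 2
  have h2 := mul_le_mul_of_nonneg_left h1 (neg_nonneg.2 A.nonpos)
  have h3 := mul_nonneg (neg_nonneg.2 A.nonpos) (sq_nonneg x)
  constructor <;> linarith [A.small]

theorem mem_model (A : Admissible κ ℓ f) (hx : x ∈ Icc (3 * ℓ / 2) (7 * ℓ / 2)) :
    0 < 4 + κ * x ^ 2 := by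
  linarith [(A.conf_mem hx).1]

theorem crv_le (A : Admissible κ ℓ f) (hx : x ∈ Icc (3 * ℓ / 2) (7 * ℓ / 2)) :
    crv κ x ≤ 1 / ℓ := by
  have h0 := A.pos_of_mem hx
  have hl := A.pos
  have h1 : x ^ 2 ≤ (7 * ℓ / 2) ^ 2 := pow_le_pow_left₀ h0.le hx.2 2
  have h2 := mul_le_mul_of_nonneg_left h1 (neg_nonneg.2 A.nonpos)
  rw [crv, div_le_div_iff₀ (by positivity) hl]
  have h3 : -κ * x ^ 2 ≤ 1 := by linarith [A.small]
  nlinarith [hx.1]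

theorem turning_ge (A : Admissible κ ℓ f) (hw : w ∈ Icc (-1 : ℝ) 1)
    (hx : x ∈ Icc (3 * ℓ / 2) (7 * ℓ / 2)) : 2 / ℓ ≤ turning κ τ f w x := by
  have h1 := A.crv_le hx
  have h2 := crv_pos A.nonpos (A.pos_of_mem hx)
  have h3 := A.lower (angleSq τ w x)
  have h4 : crv κ x * w ≤ 1 / ℓ := by nlinarith [hw.2]
  have h5 : 2 / ℓ = 3 / ℓ - 1 / ℓ := by ring
  rw [turning]
  linarith

theorem turning_pos (A : Admissible κ ℓ f) (hw : w ∈ Icc (-1 : ℝ) 1)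
    (hx : x ∈ Icc (3 * ℓ / 2) (7 * ℓ / 2)) : 0 < turning κ τ f w x :=
  (div_pos two_pos A.pos).trans_le (A.turning_ge hw hx)

theorem radialRate_pos (A : Admissible κ ℓ f) (hw : w ∈ Icc (-1 : ℝ) 1)
    (hx : x ∈ Icc (3 * ℓ / 2) (7 * ℓ / 2)) : 0 < radialRate κ τ f w x :=
  div_pos (by linarith [A.mem_model hx]) (A.turning_pos hw hx)

theorem radialRate_le (A : Admissible κ ℓ f) (hw : w ∈ Icc (-1 : ℝ) 1)
    (hx : x ∈ Icc (3 * ℓ / 2) (7 * ℓ / 2)) : radialRate κ τ f w x ≤ ℓ / 2 := by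
  have h := A.turning_ge (τ := τ) hw hx
  have hl := A.pos
  rw [radialRate, div_le_iff₀ (A.turning_pos hw hx)]
  calc (4 + κ * x ^ 2) / 4 ≤ 1 := (A.conf_mem hx).2
    _ = ℓ / 2 * (2 / ℓ) := by field_simp
    _ ≤ _ := by gcongr

theorem contDiffAt_turning (A : Admissible κ ℓ f) (hx : x ∈ Icc (3 * ℓ / 2) (7 * ℓ / 2)) :
    ContDiffAt ℝ 1 (fun p : ℝ × ℝ => turning κ τ f p.1 p.2) (w, x) := by
  have h0 : 4 * x ≠ 0 := by have := A.pos_of_mem hx; positivity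
  have h1 : 1 + τ ^ 2 * x ^ 2 ≠ 0 := by positivity
  have hy : ContDiffAt ℝ 1 (fun p : ℝ × ℝ => angleSq τ p.1 p.2) (w, x) := by
    unfold angleSq
    fun_prop (disch := assumption)
  have hc : ContDiffAt ℝ 1 (fun p : ℝ × ℝ => crv κ p.2) (w, x) := by
    unfold crv
    fun_prop (disch := assumption)
  exact (A.contDiff.contDiffAt.comp _ hy).sub (hc.mul contDiffAt_fst)

theorem contDiffAt_radialRate (A : Admissible κ ℓ f) (hw : w ∈ Icc (-1 : ℝ) 1)
    (hx : x ∈ Icc (3 * ℓ / 2) (7 * ℓ / 2)) :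
    ContDiffAt ℝ 1 (fun p : ℝ × ℝ => radialRate κ τ f p.1 p.2) (w, x) := by
  refine ContDiffAt.div (by fun_prop) (A.contDiffAt_turning hx) (A.turning_pos hw hx).ne'

theorem contDiffAt_verticalRate (A : Admissible κ ℓ f) (hw : w ∈ Icc (-1 : ℝ) 1)
    (hx : x ∈ Icc (3 * ℓ / 2) (7 * ℓ / 2)) :
    ContDiffAt ℝ 1 (fun p : ℝ × ℝ => verticalRate κ τ f p.1 p.2) (w, x) := by
  refine ContDiffAt.div ?_ (A.contDiffAt_turning hx) (A.turning_pos hw hx).ne'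
  exact ContDiffAt.sqrt (by fun_prop) (by positivity)

theorem exists_lipschitz (A : Admissible κ ℓ f) : ∃ K : NNReal, ∀ w ∈ Icc (-1 : ℝ) 1,
    LipschitzOnWith K (radialRate κ τ f w) (Icc (3 * ℓ / 2) (7 * ℓ / 2)) := by
  have hloc : LocallyLipschitzOn (Icc (-1 : ℝ) 1 ×ˢ Icc (3 * ℓ / 2) (7 * ℓ / 2))
      (fun p : ℝ × ℝ => radialRate κ τ f p.1 p.2) := fun p hp => by
    obtain ⟨K, t, ht, h⟩ := (A.contDiffAt_radialRate (τ := τ) hp.1 hp.2).exists_lipschitzOnWith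
    exact ⟨K, t, mem_nhdsWithin_of_mem_nhds ht, h⟩
  obtain ⟨K, hK⟩ := hloc.exists_lipschitzOnWith_of_compact (isCompact_Icc.prod isCompact_Icc)
  refine ⟨K, fun w hw x hx y hy => ?_⟩
  have := hK (mk_mem_prod hw hx) (mk_mem_prod hw hy)
  simpa [Prod.edist_eq] using this

/-- Solutions of `dX/dw = radialRate` on `[-1, 1]` for all initial values `X(0) ∈ [2ℓ, 3ℓ]`,
depending continuously on the initial value. -/
theorem exists_flow (A : Admissible κ ℓ f) (τ : ℝ) : ∃ α : ℝ × ℝ → ℝ,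
    (∀ ξ ∈ Icc (2 * ℓ) (3 * ℓ), α (ξ, 0) = ξ ∧ ∀ w ∈ Icc (-1 : ℝ) 1,
      α (ξ, w) ∈ Icc (ξ - ℓ / 2) (ξ + ℓ / 2) ∧
      HasDerivWithinAt (fun t => α (ξ, t)) (radialRate κ τ f w (α (ξ, w))) (Icc (-1) 1) w) ∧
    ContinuousOn α (Icc (2 * ℓ) (3 * ℓ) ×ˢ Icc (-1) 1) := by
  have hl := A.pos
  set D := Icc (3 * ℓ / 2) (7 * ℓ / 2) with hD
  have hle : 3 * ℓ / 2 ≤ 7 * ℓ / 2 := by linarith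
  -- freezing the field outside the annulus makes its bound global, so that solutions stay in it
  set F : ℝ → ℝ → ℝ := fun w x => radialRate κ τ f w (projIcc _ _ hle x) with hF
  have hFD : ∀ w, ∀ x ∈ D, F w x = radialRate κ τ f w x := fun w x hx => by
    simp only [hF, projIcc_of_mem hle hx]
  have hFle : ∀ w ∈ Icc (-1 : ℝ) 1, ∀ x, ‖F w x‖ ≤ ℓ / 2 := fun w hw x => by
    rw [Real.norm_eq_abs, abs_of_pos (A.radialRate_pos hw (projIcc _ _ hle x).2)]
    exact A.radialRate_le hw (projIcc _ _ hle x).2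
  obtain ⟨K, hK⟩ := A.exists_lipschitz (τ := τ)
  obtain ⟨lN, hlN⟩ : ∃ lN : NNReal, (lN : ℝ) = ℓ := ⟨⟨ℓ, hl.le⟩, rfl⟩
  have hball : Metric.closedBall (5 * ℓ / 2) (lN : ℝ) = D := by
    rw [Real.closedBall_eq_Icc, hD, hlN]; congr 1 <;> ring
  have hball' : Metric.closedBall (5 * ℓ / 2) ((lN / 2 : NNReal) : ℝ) = Icc (2 * ℓ) (3 * ℓ) := by
    rw [Real.closedBall_eq_Icc, NNReal.coe_div, hlN, NNReal.coe_two]; congr 1 <;> ring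
  have hPL : IsPicardLindelof F (tmin := -1) (tmax := 1) ⟨0, by norm_num⟩ (5 * ℓ / 2)
      lN (lN / 2) (lN / 2) K := by
    refine ⟨fun w hw => ?_, fun x hx => ?_, fun w hw x _ => ?_, ?_⟩
    · rw [hball]
      exact fun x hx y hy => by rw [hFD w x hx, hFD w y hy]; exact hK w hw hx hy
    · rw [hball] at hx
      refine ContinuousOn.congr (f := fun w => radialRate κ τ f w x) (fun w hw => ?_)
        fun w _ => hFD w x hx
      exact ((A.contDiffAt_radialRate (τ := τ) hw hx).continuousAt.comp
        (f := fun w => (w, x)) (by fun_prop)).continuousWithinAt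
    · simpa [hlN] using hFle w hw x
    · simp [hlN]; linarith
  obtain ⟨α, hα, hαc⟩ := hPL.exists_forall_mem_closedBall_eq_hasDerivWithinAt_continuousOn
  rw [hball'] at hα hαc
  refine ⟨α, fun ξ hξ => ?_, hαc⟩
  obtain ⟨h0, hd⟩ := hα ξ hξ
  refine ⟨h0, fun w hw => ?_⟩
  have hb := (convex_Icc (-1 : ℝ) 1).norm_image_sub_le_of_norm_hasDerivWithin_le hd
    (fun t ht => hFle t ht _) (show (0 : ℝ) ∈ Icc (-1 : ℝ) 1 by norm_num) hw
  have h0' : α (ξ, 0) = ξ := h0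
  have hw1 : ‖w - 0‖ ≤ 1 := by rw [sub_zero]; exact abs_le.2 hw
  have hb' : |α (ξ, w) - ξ| ≤ ℓ / 2 := by
    rw [h0'] at hb
    refine hb.trans ((mul_le_mul_of_nonneg_left hw1 (by positivity)).trans_eq (mul_one _))
  have hm : α (ξ, w) ∈ Icc (ξ - ℓ / 2) (ξ + ℓ / 2) := by
    rw [abs_le] at hb'
    constructor <;> linarith
  refine ⟨hm, ?_⟩
  rw [← hFD w _ ⟨by linarith [hm.1, hξ.1], by linarith [hm.2, hξ.2]⟩]
  exact hd w hw

theorem prescribedClass (A : Admissible κ ℓ f) : PrescribedClass κ (fun y => f (y ^ 2) / 2) := by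
  have hl := A.pos
  have h3 : 0 < 3 / ℓ := by positivity
  refine ⟨?_, fun y _ => by simp only [neg_sq], fun y _ => ?_, fun y hy => ?_⟩
  · have := A.contDiff.comp (contDiff_id.pow 2 : ContDiff ℝ 1 fun y : ℝ => y ^ 2)
    exact (this.div_const 2).contDiffOn
  · exact half_pos (h3.trans_le (A.lower _))
  · have h1 : (3 / ℓ) ^ 2 ≤ f (y ^ 2) ^ 2 := pow_le_pow_left₀ h3.le (A.lower _) 2
    have h2 : -κ ≤ 1 / ℓ ^ 2 := by
      rw [le_div_iff₀ (by positivity)]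
      linarith [A.small]
    have h4 : (3 / ℓ) ^ 2 = 9 * (1 / ℓ ^ 2) := by ring
    have h5 : 0 < 1 / ℓ ^ 2 := by positivity
    have h6 : -κ * (1 - y ^ 2) ≤ 1 / ℓ ^ 2 := by
      nlinarith [A.nonpos, sq_nonneg y, mul_nonneg (neg_nonneg.2 A.nonpos) (sq_nonneg y)]
    have h7 : 4 * (f (y ^ 2) / 2) ^ 2 = f (y ^ 2) ^ 2 := by ring
    simp only [h7]
    linarith

end Admissible

open Real

/-! ### Height differences along an arc -/

/-- `X` is the solution on `[-1, 1]` of `dX/dw = radialRate` with `X(0) = ξ`: the distance to the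
axis along an arc of profile, as a function of the sine of its direction angle. The bound on `X`
keeps it in the annulus of `Admissible`. -/
structure IsArc (κ τ ℓ : ℝ) (f : ℝ → ℝ) (ξ : ℝ) (X : ℝ → ℝ) : Prop where
  start_mem : ξ ∈ Icc (2 * ℓ) (3 * ℓ)
  start : X 0 = ξ
  mem : ∀ w ∈ Icc (-1 : ℝ) 1, X w ∈ Icc (ξ - ℓ / 2) (ξ + ℓ / 2)
  hasDerivWithinAt : ∀ w ∈ Icc (-1 : ℝ) 1, HasDerivWithinAt X (radialRate κ τ f w (X w)) (Icc (-1) 1) w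

/-- The derivative of the height of the profile with respect to its direction angle `φ`. -/
def heightRate (κ τ : ℝ) (f X : ℝ → ℝ) (φ : ℝ) : ℝ :=
  sin φ * verticalRate κ τ f (sin φ) (X (sin φ))

/-- The height of the profile at direction angle `φ`, normalized to vanish at the innermost point
`φ = -π/2`. -/
def height (κ τ : ℝ) (f X : ℝ → ℝ) (φ : ℝ) : ℝ :=
  ∫ t in (-(π / 2))..φ, heightRate κ τ f X t

theorem sin_mem_Icc_zero_one {φ : ℝ} (hφ : φ ∈ Icc 0 (π / 2)) : sin φ ∈ Icc (0 : ℝ) 1 :=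
  ⟨sin_nonneg_of_nonneg_of_le_pi hφ.1 (by linarith [hφ.2, pi_pos]), sin_le_one φ⟩

/-- Near the inner side of a profile starting at `x = 2ℓ` the squared angle function is at least its
value at the start, provided that `x` decreases at a rate of at least `ℓ / 5`. -/
theorem angleSq_ge {τ ℓ w x : ℝ} (hl : 0 < ℓ) (hx : 0 < x) (hw : 0 ≤ w)
    (hw' : w ≤ 4 * τ ^ 2 * ℓ ^ 2 / (5 + 21 * τ ^ 2 * ℓ ^ 2)) (hxw : x ≤ 2 * ℓ - ℓ / 5 * w) :
    1 / (1 + τ ^ 2 * (2 * ℓ) ^ 2) ≤ angleSq τ w x := by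
  rw [le_div_iff₀ (by positivity)] at hw'
  rw [angleSq, div_le_div_iff₀ (by positivity) (by positivity)]
  have h1 : x ^ 2 ≤ (2 * ℓ - ℓ / 5 * w) ^ 2 := pow_le_pow_left₀ hx.le hxw 2
  have h2 := mul_le_mul_of_nonneg_left h1 (sq_nonneg τ)
  have h3 := mul_le_mul_of_nonneg_left hw' hw
  have h4 : 0 ≤ τ ^ 2 * ℓ ^ 2 * w := by positivity
  have h5 : 0 ≤ τ ^ 2 * ℓ ^ 2 * w ^ 2 := by positivity
  nlinarith

namespace IsArc

variable {κ τ ℓ ξ : ℝ} {f X : ℝ → ℝ}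

theorem mem' (S : IsArc κ τ ℓ f ξ X) {w : ℝ} (hw : w ∈ Icc (-1 : ℝ) 1) :
    X w ∈ Icc (3 * ℓ / 2) (7 * ℓ / 2) := by
  have h1 := S.mem w hw
  have h2 := S.start_mem
  exact ⟨by linarith [h1.1, h2.1], by linarith [h1.2, h2.2]⟩

theorem strictMonoOn (S : IsArc κ τ ℓ f ξ X) (A : Admissible κ ℓ f) :
    StrictMonoOn X (Icc (-1) 1) := by
  refine strictMonoOn_of_deriv_pos (convex_Icc _ _)
    (fun w hw => (S.hasDerivWithinAt w hw).continuousWithinAt) fun w hw => ?_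
  rw [interior_Icc] at hw
  have hw' := Ioo_subset_Icc_self hw
  rw [((S.hasDerivWithinAt w hw').hasDerivAt (Icc_mem_nhds hw.1 hw.2)).deriv]
  exact A.radialRate_pos hw' (S.mem' hw')

theorem hasDerivAt_comp_sin (S : IsArc κ τ ℓ f ξ X) (φ : ℝ) :
    HasDerivAt (fun t => X (sin t)) (radialRate κ τ f (sin φ) (X (sin φ)) * cos φ) φ :=
  (S.hasDerivWithinAt _ (sin_mem_Icc φ)).comp_hasDerivAt φ (hasDerivAt_sin φ)
    (Eventually.of_forall sin_mem_Icc)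

theorem contDiff_comp_sin (S : IsArc κ τ ℓ f ξ X) (A : Admissible κ ℓ f) :
    ContDiff ℝ 1 (fun t => X (sin t)) := by
  have hc : Continuous (fun t => X (sin t)) :=
    continuous_iff_continuousAt.2 fun φ => (S.hasDerivAt_comp_sin φ).continuousAt
  rw [contDiff_one_iff_deriv]
  refine ⟨fun φ => (S.hasDerivAt_comp_sin φ).differentiableAt, ?_⟩
  rw [funext fun φ => (S.hasDerivAt_comp_sin φ).deriv]
  refine Continuous.mul (continuous_iff_continuousAt.2 fun φ => ?_) continuous_cos
  exact (A.contDiffAt_radialRate (τ := τ) (sin_mem_Icc φ)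
    (S.mem' (sin_mem_Icc φ))).continuousAt.comp (f := fun t => (sin t, X (sin t)))
    (continuous_sin.prodMk hc).continuousAt

theorem contDiff_radialRate (S : IsArc κ τ ℓ f ξ X) (A : Admissible κ ℓ f) :
    ContDiff ℝ 1 (fun φ => radialRate κ τ f (sin φ) (X (sin φ))) := by
  refine contDiff_iff_contDiffAt.2 fun φ => ?_
  exact (A.contDiffAt_radialRate (τ := τ) (sin_mem_Icc φ) (S.mem' (sin_mem_Icc φ))).comp
    (f := fun t => (sin t, X (sin t))) φ
    (contDiff_sin.contDiffAt.prodMk (S.contDiff_comp_sin A).contDiffAt)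

theorem contDiff_verticalRate (S : IsArc κ τ ℓ f ξ X) (A : Admissible κ ℓ f) :
    ContDiff ℝ 1 (fun φ => verticalRate κ τ f (sin φ) (X (sin φ))) := by
  refine contDiff_iff_contDiffAt.2 fun φ => ?_
  exact (A.contDiffAt_verticalRate (τ := τ) (sin_mem_Icc φ) (S.mem' (sin_mem_Icc φ))).comp
    (f := fun t => (sin t, X (sin t))) φ
    (contDiff_sin.contDiffAt.prodMk (S.contDiff_comp_sin A).contDiffAt)

theorem contDiff_heightRate (S : IsArc κ τ ℓ f ξ X) (A : Admissible κ ℓ f) :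
    ContDiff ℝ 1 (heightRate κ τ f X) :=
  contDiff_sin.mul (S.contDiff_verticalRate A)

theorem intervalIntegrable (S : IsArc κ τ ℓ f ξ X) (A : Admissible κ ℓ f) (a b : ℝ) :
    IntervalIntegrable (heightRate κ τ f X) MeasureTheory.volume a b :=
  (S.contDiff_heightRate A).continuous.intervalIntegrable a b

theorem verticalRate_pos (S : IsArc κ τ ℓ f ξ X) (A : Admissible κ ℓ f) {w : ℝ}
    (hw : w ∈ Icc (-1 : ℝ) 1) : 0 < verticalRate κ τ f w (X w) :=
  div_pos (rad_pos _ _) (A.turning_pos hw (S.mem' hw))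

/-- The total height difference as the rise of the outer part minus the drop of the inner part. -/
theorem integral_eq (S : IsArc κ τ ℓ f ξ X) (A : Admissible κ ℓ f) :
    ∫ φ in (-(π / 2))..(π / 2), heightRate κ τ f X φ =
      (∫ φ in (0 : ℝ)..(π / 2), heightRate κ τ f X φ) -
        ∫ φ in (0 : ℝ)..(π / 2), -heightRate κ τ f X (-φ) := by
  rw [← intervalIntegral.integral_add_adjacent_intervals (S.intervalIntegrable A _ 0)
    (S.intervalIntegrable A 0 _), intervalIntegral.integral_neg,
    intervalIntegral.integral_comp_neg (fun φ => heightRate κ τ f X φ), neg_zero]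
  ring

/-- An arc of constant mean curvature rises in total. -/
theorem integral_nonneg_of_const (S : IsArc κ τ ℓ f ξ X) (A : Admissible κ ℓ f) {a y₁ : ℝ}
    (hξ : ξ = 3 * ℓ) (hy₁ : y₁ = 1 / (1 + τ ^ 2 * (5 * ℓ / 2) ^ 2)) (hf : ∀ y ≤ y₁, f y = a) :
    0 ≤ ∫ φ in (-(π / 2))..(π / 2), heightRate κ τ f X φ := by
  have hl := A.pos
  have hfa : ∀ w ∈ Icc (-1 : ℝ) 1, f (angleSq τ w (X w)) = a := fun w hw => by
    refine hf _ ?_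
    have h1 := (S.mem w hw).1
    rw [hy₁, angleSq]
    have : (5 * ℓ / 2) ^ 2 ≤ X w ^ 2 := pow_le_pow_left₀ (by positivity) (by linarith) 2
    gcongr
    nlinarith [sq_nonneg w]
  rw [S.integral_eq A, sub_nonneg]
  refine intervalIntegral.integral_mono_on (by positivity)
    (((S.contDiff_heightRate A).continuous.comp continuous_neg).neg.intervalIntegrable _ _)
    (S.intervalIntegrable A _ _) fun φ hφ => ?_
  have hw := sin_mem_Icc_zero_one hφ
  rw [heightRate, heightRate, sin_neg, neg_mul, neg_neg]
  set w := sin φ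
  have h1 : w ∈ Icc (-1 : ℝ) 1 := ⟨by linarith [hw.1], hw.2⟩
  have h2 : -w ∈ Icc (-1 : ℝ) 1 := ⟨by linarith [hw.2], by linarith [hw.1]⟩
  have h3 : X (-w) ≤ X w := (S.strictMonoOn A).monotoneOn h2 h1 (by linarith [hw.1])
  have h4 := A.pos_of_mem (S.mem' h2)
  have hw0 := hw.1
  refine mul_le_mul_of_nonneg_left ?_ hw0
  refine div_le_div₀ (rad_pos _ _).le (Real.sqrt_le_sqrt (by gcongr)) (A.turning_pos h1 (S.mem' h1)) ?_
  rw [turning, turning, hfa w h1, hfa _ h2]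
  have h5 := mul_nonneg (crv_pos A.nonpos (A.pos_of_mem (S.mem' h1))).le hw0
  have h6 := mul_nonneg (crv_pos A.nonpos (A.pos_of_mem (S.mem' h2))).le hw0
  linarith

/-- Barrier for the inner part of the arc starting at `2ℓ`. As long as it lies below the barrier, the
squared angle function is in the range where `f` takes its smallest value `3 / ℓ`, which forces `X`
to move faster than the barrier. -/
theorem left_arc_le (S : IsArc κ τ ℓ f ξ X) (A : Admissible κ ℓ f) (hξ : ξ = 2 * ℓ)
    (hf : ∀ y, 1 / (1 + τ ^ 2 * (2 * ℓ) ^ 2) ≤ y → f y = 3 / ℓ) {w : ℝ} (hw : 0 ≤ w)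
    (hw' : w ≤ 4 * τ ^ 2 * ℓ ^ 2 / (5 + 21 * τ ^ 2 * ℓ ^ 2)) : X (-w) ≤ 2 * ℓ - ℓ / 5 * w := by
  have hl := A.pos
  set c := 4 * τ ^ 2 * ℓ ^ 2 / (5 + 21 * τ ^ 2 * ℓ ^ 2) with hc
  have hc1 : c < 1 := by
    rw [hc, div_lt_one (by positivity)]
    nlinarith [mul_nonneg (sq_nonneg τ) (sq_nonneg ℓ)]
  have hneg : ∀ t ∈ Icc (-1 : ℝ) 1, -t ∈ Icc (-1 : ℝ) 1 := fun t ht =>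
    ⟨by linarith [ht.2], by linarith [ht.1]⟩
  have hd : ∀ t ∈ Icc (-1 : ℝ) 1, HasDerivWithinAt (fun s => X (-s))
      (-radialRate κ τ f (-t) (X (-t))) (Icc (-1) 1) t := fun t ht =>
    ((S.hasDerivWithinAt (-t) (hneg t ht)).comp t (hasDerivAt_neg t).hasDerivWithinAt hneg).congr_deriv
      (by ring)
  have hsub : Icc 0 c ⊆ Icc (-1 : ℝ) 1 := Icc_subset_Icc (by norm_num) hc1.le
  refine image_le_of_deriv_right_lt_deriv_boundary' (a := 0) (b := c) (f := fun s => X (-s))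
    (f' := fun t => -radialRate κ τ f (-t) (X (-t))) (B := fun t => 2 * ℓ - ℓ / 5 * t)
    (B' := fun _ => -(ℓ / 5)) (fun t ht => (hd t (hsub ht)).continuousWithinAt.mono hsub)
    (fun t ht => ?_) (by simp [S.start, hξ]) (by fun_prop) (fun t _ => ?_)
    (fun t ht h => ?_) ⟨hw, hw'⟩
  · exact (hd t (hsub (Ico_subset_Icc_self ht))).mono_of_mem_nhdsWithin
      (Icc_mem_nhdsGE_of_mem ⟨by linarith [ht.1], ht.2.trans hc1⟩)
  · exact (((hasDerivAt_id t).const_mul (ℓ / 5)).const_sub (2 * ℓ)).hasDerivWithinAt.congr_deriv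
      (by ring)
  · have ht1 := hneg t (hsub (Ico_subset_Icc_self ht))
    have hx := S.mem' ht1
    have hx0 := A.pos_of_mem hx
    have hfx := hf _ (angleSq_ge hl hx0 ht.1 ht.2.le h.le)
    have hang : angleSq τ (-t) (X (-t)) = angleSq τ t (X (-t)) := by simp [angleSq]
    have h1 : turning κ τ f (-t) (X (-t)) ≤ 4 / ℓ := by
      rw [turning, hang, hfx]
      have h2 := A.crv_le hx
      have h3 := crv_pos A.nonpos hx0
      have h4 : crv κ (X (-t)) * t ≤ 1 / ℓ := by nlinarith [ht.1, ht.2]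
      have h5 : 4 / ℓ = 3 / ℓ + 1 / ℓ := by ring
      linarith
    have h2 := A.turning_pos (τ := τ) ht1 hx
    rw [neg_lt_neg_iff, radialRate, lt_div_iff₀ h2]
    calc ℓ / 5 * turning κ τ f (-t) (X (-t)) ≤ ℓ / 5 * (4 / ℓ) := by gcongr
      _ = 4 / 5 := by field_simp
      _ < _ := by linarith [(A.conf_mem hx).1]

/-- The drop of the inner part is bounded below independently of the values of `f` below the squared
angle function at the start. -/
theorem le_integral_left (S : IsArc κ τ ℓ f ξ X) (A : Admissible κ ℓ f) (hξ : ξ = 2 * ℓ)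
    (hf : ∀ y, 1 / (1 + τ ^ 2 * (2 * ℓ) ^ 2) ≤ y → f y = 3 / ℓ) :
    ℓ / 4 * (1 - cos (arcsin (4 * τ ^ 2 * ℓ ^ 2 / (5 + 21 * τ ^ 2 * ℓ ^ 2)))) ≤
      ∫ φ in (0 : ℝ)..(π / 2), -heightRate κ τ f X (-φ) := by
  have hl := A.pos
  set c := 4 * τ ^ 2 * ℓ ^ 2 / (5 + 21 * τ ^ 2 * ℓ ^ 2) with hc
  have hc0 : 0 ≤ c := by positivity
  have hc1 : c < 1 := by
    rw [hc, div_lt_one (by positivity)]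
    nlinarith [mul_nonneg (sq_nonneg τ) (sq_nonneg ℓ)]
  set φ₀ := arcsin c with hφ₀
  have h0 : 0 ≤ φ₀ := arcsin_nonneg.2 hc0
  have h1 : φ₀ ≤ π / 2 := arcsin_le_pi_div_two c
  have hint : ∀ a b, IntervalIntegrable (fun φ => -heightRate κ τ f X (-φ)) MeasureTheory.volume
      a b := fun a b =>
    ((S.contDiff_heightRate A).continuous.comp continuous_neg).neg.intervalIntegrable _ _
  have hnegmem : ∀ φ, -sin φ ∈ Icc (-1 : ℝ) 1 := fun φ => by
    rw [← sin_neg]; exact sin_mem_Icc _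
  rw [← intervalIntegral.integral_add_adjacent_intervals (hint 0 φ₀) (hint φ₀ _)]
  have hsecond : 0 ≤ ∫ φ in φ₀..(π / 2), -heightRate κ τ f X (-φ) := by
    refine intervalIntegral.integral_nonneg h1 fun φ hφ => ?_
    rw [heightRate, sin_neg, neg_mul, neg_neg]
    exact mul_nonneg (sin_mem_Icc_zero_one ⟨h0.trans hφ.1, hφ.2⟩).1 (S.verticalRate_pos A (hnegmem φ)).le
  have hfirst : ∫ φ in (0 : ℝ)..φ₀, sin φ * (ℓ / 4) ≤
      ∫ φ in (0 : ℝ)..φ₀, -heightRate κ τ f X (-φ) := by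
    refine intervalIntegral.integral_mono_on h0
      ((continuous_sin.mul continuous_const).intervalIntegrable _ _) (hint _ _) fun φ hφ => ?_
    rw [heightRate, sin_neg, neg_mul, neg_neg]
    have hw := sin_mem_Icc_zero_one ⟨hφ.1, hφ.2.trans h1⟩
    refine mul_le_mul_of_nonneg_left ?_ hw.1
    have hwc : sin φ ≤ c := by
      rw [← sin_arcsin (by linarith) hc1.le]
      exact sin_le_sin_of_le_of_le_pi_div_two (by linarith [hφ.1, pi_pos]) h1 hφ.2
    have hx := S.mem' (hnegmem φ)
    have hx0 := A.pos_of_mem hx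
    have hfx := hf _ (angleSq_ge hl hx0 hw.1 hwc (S.left_arc_le A hξ hf hw.1 hwc))
    have hang : angleSq τ (-sin φ) (X (-sin φ)) = angleSq τ (sin φ) (X (-sin φ)) := by
      simp [angleSq]
    have h2 : turning κ τ f (-sin φ) (X (-sin φ)) ≤ 4 / ℓ := by
      rw [turning, hang, hfx]
      have h2 := A.crv_le hx
      have h3 := crv_pos A.nonpos hx0
      have h4 : crv κ (X (-sin φ)) * sin φ ≤ 1 / ℓ := by nlinarith [hw.1, hw.2]
      have h5 : 4 / ℓ = 3 / ℓ + 1 / ℓ := by ring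
      linarith
    rw [verticalRate, le_div_iff₀ (A.turning_pos (hnegmem φ) hx)]
    calc ℓ / 4 * turning κ τ f (-sin φ) (X (-sin φ)) ≤ ℓ / 4 * (4 / ℓ) := by gcongr
      _ = 1 := by field_simp
      _ ≤ rad τ (X (-sin φ)) := Real.one_le_sqrt.2 (le_add_of_nonneg_right (by positivity))
  have hcalc : ∫ φ in (0 : ℝ)..φ₀, sin φ * (ℓ / 4) = ℓ / 4 * (1 - cos φ₀) := by
    rw [intervalIntegral.integral_mul_const, integral_sin, cos_zero, mul_comm]
  linarith

/-- The rise of the outer part is small if `f` takes a large value `a`, except in a thin band of width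
`δ` below the squared angle function at the start. -/
theorem integral_right_le (S : IsArc κ τ ℓ f ξ X) (A : Admissible κ ℓ f) (hξ : ξ = 2 * ℓ)
    {a δ ζ : ℝ} (hζ : 0 < ζ) (ha : 1 / ℓ + 4 * rad τ (7 * ℓ / 2) / ζ ≤ a)
    (hδ : δ ≤ 1 / (1 + τ ^ 2 * (2 * ℓ) ^ 2) * (ζ / (2 * rad τ (7 * ℓ / 2) * ℓ)) ^ 2)
    (hf : ∀ y ≤ 1 / (1 + τ ^ 2 * (2 * ℓ) ^ 2) - δ, f y = a) :
    ∫ φ in (0 : ℝ)..(π / 2), heightRate κ τ f X φ ≤ ζ / 2 := by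
  have hl := A.pos
  set R := rad τ (7 * ℓ / 2) with hR
  have hR0 : 0 < R := rad_pos _ _
  set y := 1 / (1 + τ ^ 2 * (2 * ℓ) ^ 2) with hy
  have hy0 : 0 < y := by positivity
  have hbound : ∀ φ ∈ Icc 0 (π / 2), heightRate κ τ f X φ ≤ ζ / 4 := by
    intro φ hφ
    have hw := sin_mem_Icc_zero_one hφ
    rw [heightRate]
    set w := sin φ
    have hw1 : w ∈ Icc (-1 : ℝ) 1 := ⟨by linarith [hw.1], hw.2⟩
    have hx := S.mem' hw1
    have hx0 := A.pos_of_mem hx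
    have hrad : rad τ (X w) ≤ R := Real.sqrt_le_sqrt (by have := hx.2; gcongr)
    have hxξ : 2 * ℓ ≤ X w := by
      rw [← hξ, ← S.start]
      exact (S.strictMonoOn A).monotoneOn (by norm_num) hw1 hw.1
    have hang : angleSq τ w (X w) ≤ (1 - w ^ 2) * y := by
      rw [angleSq, hy, mul_one_div]
      have : 0 ≤ 1 - w ^ 2 := by nlinarith [hw.1, hw.2]
      gcongr
    -- either the mean curvature is large, or `w` is still small
    rcases le_or_gt (angleSq τ w (X w)) (y - δ) with h | h
    · have hT : 4 * R / ζ ≤ turning κ τ f w (X w) := by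
        rw [turning, hf _ h]
        have h2 := A.crv_le hx
        have h3 := crv_pos A.nonpos hx0
        have h4 : crv κ (X w) * w ≤ 1 / ℓ := by nlinarith [hw.1, hw.2]
        linarith
      calc w * verticalRate κ τ f w (X w) ≤ 1 * (R / (4 * R / ζ)) :=
            mul_le_mul hw.2 (div_le_div₀ hR0.le hrad (by positivity) hT)
              (S.verticalRate_pos A hw1).le zero_le_one
        _ = ζ / 4 := by field_simp
    · have hwlt : w ≤ ζ / (2 * R * ℓ) := by
        refine le_of_sq_le_sq ?_ (by positivity)
        have : y * w ^ 2 ≤ y * (ζ / (2 * R * ℓ)) ^ 2 := by linarith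
        exact le_of_mul_le_mul_left this hy0
      calc w * verticalRate κ τ f w (X w) ≤ ζ / (2 * R * ℓ) * (R / (2 / ℓ)) :=
            mul_le_mul hwlt (div_le_div₀ hR0.le hrad (by positivity) (A.turning_ge hw1 hx))
              (S.verticalRate_pos A hw1).le (by positivity)
        _ = ζ / 4 := by field_simp; norm_num
  have h := intervalIntegral.integral_mono_on (by positivity : (0 : ℝ) ≤ π / 2)
    (S.intervalIntegrable A _ _) (continuous_const.intervalIntegrable _ _) hbound
  rw [intervalIntegral.integral_const, sub_zero, smul_eq_mul] at h
  nlinarith [pi_le_four]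

end IsArc

/-- There is a closed profile. The function `f` is `3 / ℓ` for squared angle functions above the value
`y₂` at `x = 2ℓ`, `σ = 0`, and a large constant `a` below `y₂ - δ`. Starting at `ξ = 2ℓ`, the inner
part of the arc sees small mean curvature and the outer part large mean curvature, so the arc drops
in total; starting at `ξ = 3ℓ`, the mean curvature is constant and the arc rises. The intermediate
value theorem in `ξ` closes the arc. -/
theorem exists_isArc_integral_eq_zero {κ τ : ℝ} (hκ : κ ≤ 0) (hτ : 0 < τ) :
    ∃ (ℓ ξ : ℝ) (f X : ℝ → ℝ), Admissible κ ℓ f ∧ IsArc κ τ ℓ f ξ X ∧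
      ∫ φ in (-(π / 2))..(π / 2), heightRate κ τ f X φ = 0 := by
  set ℓ : ℝ := 1 / (4 * (1 - κ)) with hℓ
  have hl : 0 < ℓ := by
    have : 0 < 1 - κ := by linarith
    positivity
  have hsmall : -κ * ℓ ^ 2 ≤ 1 / 50 := by
    have h1 : 0 < 1 - κ := by linarith
    rw [hℓ, div_pow, one_pow, mul_one_div, div_le_div_iff₀ (by positivity) (by norm_num)]
    nlinarith [sq_nonneg (1 + κ)]
  -- the squared angle function at `σ = 0`, `x = 2ℓ`, and its upper bound on arcs from `3ℓ`
  set y₂ := 1 / (1 + τ ^ 2 * (2 * ℓ) ^ 2) with hy₂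
  set y₁ := 1 / (1 + τ ^ 2 * (5 * ℓ / 2) ^ 2) with hy₁
  have hy : y₁ < y₂ := by
    rw [hy₁, hy₂]
    gcongr
    linarith
  have hy₂0 : 0 < y₂ := by positivity
  -- `ζ` bounds the drop of the inner part from below, whatever `a` and `δ` are
  set c := 4 * τ ^ 2 * ℓ ^ 2 / (5 + 21 * τ ^ 2 * ℓ ^ 2) with hc
  have hc0 : 0 < c := by positivity
  set ζ := ℓ / 4 * (1 - cos (arcsin c)) with hζ
  have hζ0 : 0 < ζ := by
    have h1 : 0 < arcsin c := arcsin_pos.2 hc0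
    have h2 : cos (arcsin c) < cos 0 :=
      cos_lt_cos_of_nonneg_of_le_pi_div_two le_rfl (arcsin_le_pi_div_two c) h1
    rw [cos_zero] at h2
    have : 0 < 1 - cos (arcsin c) := by linarith
    positivity
  set R := rad τ (7 * ℓ / 2) with hR
  have hR0 : 0 < R := rad_pos _ _
  set a := 3 / ℓ + 4 * R / ζ with ha
  have ha3 : 3 / ℓ ≤ a := by
    have : 0 ≤ 4 * R / ζ := by positivity
    linarith
  set δ := min (y₂ - y₁) (y₂ * (ζ / (2 * R * ℓ)) ^ 2) with hδ
  have hδ0 : 0 < δ := lt_min (by linarith) (by positivity)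
  set f : ℝ → ℝ := fun y => a - (a - 3 / ℓ) * smoothTransition ((y - y₂) / δ + 1) with hf
  have A : Admissible κ ℓ f := by
    refine ⟨hκ, hl, hsmall, ?_, fun y => ?_⟩
    · have : ContDiff ℝ 1 fun y : ℝ => smoothTransition ((y - y₂) / δ + 1) :=
        smoothTransition.contDiff.comp (by fun_prop)
      fun_prop
    · have h1 := smoothTransition.le_one ((y - y₂) / δ + 1)
      have h2 : 0 ≤ a - 3 / ℓ := by linarith
      simp only [hf]
      nlinarith
  have hfhigh : ∀ y, y₂ ≤ y → f y = 3 / ℓ := fun y h => by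
    have : 0 ≤ (y - y₂) / δ := div_nonneg (by linarith) hδ0.le
    simp only [hf, smoothTransition.one_of_one_le (by linarith : 1 ≤ (y - y₂) / δ + 1)]
    ring
  have hflow : ∀ y ≤ y₂ - δ, f y = a := fun y h => by
    have : (y - y₂) / δ ≤ -1 := by rw [div_le_iff₀ hδ0]; linarith
    simp only [hf, smoothTransition.zero_of_nonpos (by linarith : (y - y₂) / δ + 1 ≤ 0)]
    ring
  obtain ⟨α, hα, hαc⟩ := A.exists_flow τ
  have hS : ∀ ξ ∈ Icc (2 * ℓ) (3 * ℓ), IsArc κ τ ℓ f ξ (fun w => α (ξ, w)) := fun ξ hξ =>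
    ⟨hξ, (hα ξ hξ).1, fun w hw => ((hα ξ hξ).2 w hw).1, fun w hw => ((hα ξ hξ).2 w hw).2⟩
  have hcont : Continuous fun ξ : Icc (2 * ℓ) (3 * ℓ) =>
      ∫ φ in (-(π / 2))..(π / 2), heightRate κ τ f (fun w => α (ξ, w)) φ := by
    refine intervalIntegral.continuous_parametric_intervalIntegral_of_continuous' ?_ _ _
    have h1 : Continuous fun p : Icc (2 * ℓ) (3 * ℓ) × ℝ => α (p.1, sin p.2) :=
      hαc.comp_continuous (by fun_prop) fun p => ⟨p.1.2, sin_mem_Icc p.2⟩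
    refine Continuous.mul (by fun_prop) (continuous_iff_continuousAt.2 fun p => ?_)
    exact (A.contDiffAt_verticalRate (τ := τ) (sin_mem_Icc p.2)
      ((hS _ p.1.2).mem' (sin_mem_Icc p.2))).continuousAt.comp
      (f := fun p : Icc (2 * ℓ) (3 * ℓ) × ℝ => (sin p.2, α (p.1, sin p.2)))
      ((continuous_sin.comp continuous_snd).prodMk h1).continuousAt
  have h2l : 2 * ℓ ∈ Icc (2 * ℓ) (3 * ℓ) := ⟨le_rfl, by linarith⟩
  have h3l : 3 * ℓ ∈ Icc (2 * ℓ) (3 * ℓ) := ⟨by linarith, le_rfl⟩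
  have hneg : ∫ φ in (-(π / 2))..(π / 2), heightRate κ τ f (fun w => α (2 * ℓ, w)) φ ≤ 0 := by
    rw [(hS _ h2l).integral_eq A]
    have h1 := (hS _ h2l).le_integral_left A rfl hfhigh
    have h2 := (hS _ h2l).integral_right_le A rfl (a := a) (δ := δ) hζ0
      (by rw [ha]; gcongr; norm_num) (min_le_right _ _) hflow
    linarith
  have hpos : 0 ≤ ∫ φ in (-(π / 2))..(π / 2), heightRate κ τ f (fun w => α (3 * ℓ, w)) φ :=
    (hS _ h3l).integral_nonneg_of_const A rfl hy₁ fun y h =>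
      hflow y (by linarith [min_le_left (y₂ - y₁) (y₂ * (ζ / (2 * R * ℓ)) ^ 2)])
  have : PreconnectedSpace (Icc (2 * ℓ) (3 * ℓ)) :=
    Subtype.preconnectedSpace isPreconnected_Icc
  obtain ⟨ξ, hξ⟩ := mem_range_of_exists_le_of_exists_ge hcont ⟨⟨_, h2l⟩, hneg⟩ ⟨⟨_, h3l⟩, hpos⟩
  exact ⟨ℓ, ξ, f, _, A, hS ξ ξ.2, hξ⟩

/-! ### The torus generated by a closed arc -/

section profileNormal

variable {κ τ x : ℝ} (z x' z' : ℝ)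

theorem metric_profileNormal_self (hm : 0 < 4 + κ * x ^ 2) :
    metric κ τ ![x, 0, z] (profileNormal κ τ x x' z') (profileNormal κ τ x x' z') =
      (lam κ x * rad τ x * x') ^ 2 + z' ^ 2 := by
  have hl := lam_pos hm
  simp [metric, conf_profile, profileNormal, mul_pow, rad_sq]
  field_simp
  ring

theorem metric_profileNormal_du (hm : 0 < 4 + κ * x ^ 2) :
    metric κ τ ![x, 0, z] (profileNormal κ τ x x' z') ![x', 0, z'] = 0 := by
  have hl := lam_pos hm
  simp [metric, conf_profile, profileNormal, rad_sq]
  field_simp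
  ring

theorem metric_profileNormal_dv :
    metric κ τ ![x, 0, z] (profileNormal κ τ x x' z') ![0, x, 0] = 0 := by
  simp [metric, conf_profile, profileNormal, rad_sq]
  ring

theorem metric_profileNormal_xi :
    metric κ τ ![x, 0, z] (profileNormal κ τ x x' z') xi = lam κ x * x' := by
  simp [metric, conf_profile, profileNormal, rad_sq, xi]
  ring

end profileNormal

theorem metric_smul_left (κ τ s : ℝ) (p v w : Fin 3 → ℝ) :
    metric κ τ p (s • v) w = s * metric κ τ p v w := by
  simp [metric]; ring

theorem metric_smul_right (κ τ s : ℝ) (p v w : Fin 3 → ℝ) :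
    metric κ τ p v (s • w) = s * metric κ τ p v w := by
  simp [metric]; ring

namespace IsArc

variable {κ τ ℓ ξ : ℝ} {f X : ℝ → ℝ}

theorem hasDerivAt_height (S : IsArc κ τ ℓ f ξ X) (A : Admissible κ ℓ f) (φ : ℝ) :
    HasDerivAt (height κ τ f X) (heightRate κ τ f X φ) φ :=
  (S.contDiff_heightRate A).continuous.integral_hasStrictDerivAt _ _ |>.hasDerivAt

/-- If the arc closes up, the profile is symmetric under reflection in the plane `z = 0`. -/
theorem height_pi_sub (S : IsArc κ τ ℓ f ξ X) (A : Admissible κ ℓ f)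
    (h0 : ∫ φ in (-(π / 2))..(π / 2), heightRate κ τ f X φ = 0) (φ : ℝ) :
    height κ τ f X (π - φ) = -height κ τ f X φ := by
  have hsymm : ∀ t, heightRate κ τ f X (π - t) = heightRate κ τ f X t := fun t => by
    simp only [heightRate, sin_pi_sub]
  have hi := S.intervalIntegrable A
  have h1 := intervalIntegral.integral_comp_sub_left (a := φ) (b := π / 2)
    (fun t => heightRate κ τ f X t) π
  simp only [hsymm] at h1
  have h2 : π - π / 2 = π / 2 := by ring
  rw [h2] at h1
  rw [height, height, ← intervalIntegral.integral_add_adjacent_intervals (hi _ (π / 2)) (hi _ _),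
    ← h1, h0, zero_add]
  rw [← intervalIntegral.integral_add_adjacent_intervals (hi _ φ) (hi _ _)] at h0
  linarith

theorem height_neg_pi_div_two : height κ τ f X (-(π / 2)) = 0 := intervalIntegral.integral_same

theorem height_periodic (S : IsArc κ τ ℓ f ξ X) (A : Admissible κ ℓ f)
    (h0 : ∫ φ in (-(π / 2))..(π / 2), heightRate κ τ f X φ = 0) :
    Function.Periodic (height κ τ f X) (2 * π) := by
  have hper : Function.Periodic (heightRate κ τ f X) (2 * π) := fun t => by
    simp only [heightRate, sin_add_two_pi]
  have h1 : height κ τ f X (-(π / 2) + 2 * π) = 0 := by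
    rw [show -(π / 2) + 2 * π = π - -(π / 2) by ring, S.height_pi_sub A h0,
      height_neg_pi_div_two, neg_zero]
  intro φ
  rw [height, height, ← intervalIntegral.integral_add_adjacent_intervals
    (S.intervalIntegrable A _ φ) (S.intervalIntegrable A _ _),
    hper.intervalIntegral_add_eq φ (-(π / 2))]
  exact (congrArg _ h1).trans (add_zero _)

theorem height_neg (S : IsArc κ τ ℓ f ξ X) (A : Admissible κ ℓ f)
    (h0 : ∫ φ in (-(π / 2))..(π / 2), heightRate κ τ f X φ = 0) {φ : ℝ}
    (hφ : φ ∈ Ioo (-(π / 2)) (π / 2)) : height κ τ f X φ < 0 := by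
  have hc : Continuous (height κ τ f X) :=
    continuous_iff_continuousAt.2 fun u => (S.hasDerivAt_height A u).continuousAt
  have hv : ∀ u, 0 < verticalRate κ τ f (sin u) (X (sin u)) := fun u =>
    S.verticalRate_pos A (sin_mem_Icc u)
  rcases le_or_gt φ 0 with h | h
  · have hanti : StrictAntiOn (height κ τ f X) (Icc (-(π / 2)) 0) := by
      refine strictAntiOn_of_deriv_neg (convex_Icc _ _) hc.continuousOn fun u hu => ?_
      rw [interior_Icc] at hu
      rw [(S.hasDerivAt_height A u).deriv]
      exact mul_neg_of_neg_of_pos (sin_neg_of_neg_of_neg_pi_lt hu.2 (by linarith [hu.1, pi_pos]))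
        (hv u)
    have := hanti ⟨le_rfl, by linarith [pi_pos]⟩ ⟨hφ.1.le, h⟩ hφ.1
    rwa [height_neg_pi_div_two] at this
  · have hmono : StrictMonoOn (height κ τ f X) (Icc 0 (π / 2)) := by
      refine strictMonoOn_of_deriv_pos (convex_Icc _ _) hc.continuousOn fun u hu => ?_
      rw [interior_Icc] at hu
      rw [(S.hasDerivAt_height A u).deriv]
      exact mul_pos (sin_pos_of_pos_of_lt_pi hu.1 (by linarith [hu.2, pi_pos])) (hv u)
    have := hmono ⟨h.le, hφ.2.le⟩ ⟨by positivity, le_rfl⟩ hφ.2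
    exact this.trans_eq h0

theorem cos_eq_zero_of_height (S : IsArc κ τ ℓ f ξ X) (A : Admissible κ ℓ f)
    (h0 : ∫ φ in (-(π / 2))..(π / 2), heightRate κ τ f X φ = 0) {φ : ℝ}
    (hφ : height κ τ f X φ = 0) : cos φ = 0 := by
  obtain ⟨n, hn, -⟩ := existsUnique_sub_zsmul_mem_Ico two_pi_pos φ (-(π / 2))
  rw [zsmul_eq_mul] at hn
  rw [← cos_sub_int_mul_two_pi φ n]
  rw [← (S.height_periodic A h0).sub_int_mul_eq n] at hφ
  set t := φ - n * (2 * π)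
  rcases lt_trichotomy t (π / 2) with h | h | h
  · rcases hn.1.eq_or_lt with h1 | h1
    · rw [← h1, cos_neg, cos_pi_div_two]
    · exact absurd hφ (S.height_neg A h0 ⟨h1, h⟩).ne
  · rw [h, cos_pi_div_two]
  · have := S.height_neg A h0 (φ := π - t) ⟨by linarith [hn.2], by linarith⟩
    rw [S.height_pi_sub A h0, hφ, neg_zero] at this
    exact absurd this (lt_irrefl _)

theorem isInjectiveTorus (S : IsArc κ τ ℓ f ξ X) (A : Admissible κ ℓ f)
    (h0 : ∫ φ in (-(π / 2))..(π / 2), heightRate κ τ f X φ = 0) :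
    IsInjectiveTorus (2 * π) (2 * π)
      (rotationSurface (fun u => X (sin u)) (height κ τ f X)) := by
  have hangle : ∀ a b : ℝ, cos a = cos b → sin a = sin b → ∃ n : ℤ, b = a + n * (2 * π) := by
    intro a b hc hs
    obtain ⟨n, hn⟩ := Real.Angle.angle_eq_iff_two_pi_dvd_sub.1
      (Real.Angle.cos_sin_inj hc.symm hs.symm)
    exact ⟨n, by linear_combination hn⟩
  intro u v u' v' h
  have e0 := congrFun h 0
  have e1 := congrFun h 1
  have e2 := congrFun h 2
  simp [rotationSurface, rotation] at e0 e1 e2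
  have hx := A.pos_of_mem (S.mem' (sin_mem_Icc u))
  have hx' := A.pos_of_mem (S.mem' (sin_mem_Icc u'))
  have hxx : X (sin u) = X (sin u') := by
    refine (sq_eq_sq₀ hx.le hx'.le).1 ?_
    have e3 : X (sin u) ^ 2 * (sin v ^ 2 + cos v ^ 2) = X (sin u') ^ 2 * (sin v' ^ 2 + cos v' ^ 2) := by
      linear_combination (X (sin u) * cos v + X (sin u') * cos v') * e0 +
        (X (sin u) * sin v + X (sin u') * sin v') * e1
    simpa only [sin_sq_add_cos_sq, mul_one] using e3
  rw [hxx] at e0 e1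
  refine ⟨?_, hangle v v' (mul_left_cancel₀ hx'.ne' e0) (mul_left_cancel₀ hx'.ne' e1)⟩
  have hs : sin u = sin u' := (S.strictMonoOn A).injOn (sin_mem_Icc u) (sin_mem_Icc u') hxx
  rcases sq_eq_sq_iff_eq_or_eq_neg.1
    (show cos u ^ 2 = cos u' ^ 2 by rw [cos_sq', cos_sq', hs]) with hc | hc
  · exact hangle u u' hc hs
  · obtain ⟨n, hn⟩ := hangle (π - u) u' (by rw [cos_pi_sub, hc, neg_neg])
      (by rw [sin_pi_sub, hs])
    have hz : height κ τ f X u = 0 := by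
      have : height κ τ f X u' = -height κ τ f X u := by
        rw [hn, ← S.height_pi_sub A h0, (S.height_periodic A h0).int_mul n]
      linarith
    have hcu := S.cos_eq_zero_of_height A h0 hz
    exact hangle u u' (by linarith) hs

/-- If the arc closes up, the profile parametrized by its direction angle generates a rotational
`𝔥`-torus for `𝔥(ν) = f(ν²) / 2`. -/
theorem isRotationalHTorus (S : IsArc κ τ ℓ f ξ X) (A : Admissible κ ℓ f)
    (h0 : ∫ φ in (-(π / 2))..(π / 2), heightRate κ τ f X φ = 0) :
    IsRotationalHTorus κ τ (fun y => f (y ^ 2) / 2) (2 * π) (fun u => X (sin u))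
      (height κ τ f X) := by
  set x : ℝ → ℝ := fun u => X (sin u) with hxdef
  set z : ℝ → ℝ := height κ τ f X with hzdef
  set r : ℝ → ℝ := fun u => radialRate κ τ f (sin u) (X (sin u)) with hr
  set ρ : ℝ → ℝ := fun u => verticalRate κ τ f (sin u) (X (sin u)) with hρ
  set x' : ℝ → ℝ := fun u => r u * cos u with hx'def
  set z' : ℝ → ℝ := heightRate κ τ f X with hz'def
  have hmem : ∀ u, x u ∈ Icc (3 * ℓ / 2) (7 * ℓ / 2) := fun u => S.mem' (sin_mem_Icc u)
  have hxpos : ∀ u, 0 < x u := fun u => A.pos_of_mem (hmem u)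
  have hm : ∀ u, 0 < 4 + κ * x u ^ 2 := fun u => A.mem_model (hmem u)
  have hx : ∀ u, HasDerivAt x (x' u) u := S.hasDerivAt_comp_sin
  have hz : ∀ u, HasDerivAt z (z' u) u := S.hasDerivAt_height A
  have hx'C : ContDiff ℝ 1 x' := (S.contDiff_radialRate A).mul contDiff_cos
  have hz'C : ContDiff ℝ 1 z' := S.contDiff_heightRate A
  have hρC : ContDiff ℝ 1 ρ := S.contDiff_verticalRate A
  have hC2 : ∀ g g' : ℝ → ℝ, (∀ u, HasDerivAt g (g' u) u) → ContDiff ℝ 1 g' → ContDiff ℝ 2 g := by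
    intro g g' hg hg'
    rw [show (2 : WithTop ℕ∞) = 1 + 1 by norm_num, contDiff_succ_iff_deriv]
    refine ⟨fun u => (hg u).differentiableAt, by simp, ?_⟩
    rwa [funext fun u => (hg u).deriv]
  have hxC : ContDiff ℝ 2 x := hC2 x x' hx hx'C
  have hzC : ContDiff ℝ 2 z := hC2 z z' hz hz'C
  have hd : ∀ g : ℝ → ℝ, ContDiff ℝ 1 g → ∀ u, HasDerivAt g (deriv g u) u := fun g hg u =>
    (hg.differentiable (by norm_num)).differentiableAt.hasDerivAt
  have hρ0 : ∀ u, 0 < ρ u := fun u => S.verticalRate_pos A (sin_mem_Icc u)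
  have hr0 : ∀ u, 0 < r u := fun u => A.radialRate_pos (sin_mem_Icc u) (hmem u)
  have hp : ∀ u, lam κ (x u) * rad τ (x u) * x' u = ρ u * cos u := fun u => by
    have h1 := hm u
    have h2 := A.turning_pos (τ := τ) (sin_mem_Icc u) (hmem u)
    simp only [hx'def, hr, hρ, radialRate, verticalRate, lam]
    simp only [hxdef] at h1 h2 ⊢
    field_simp
  have hz'eq : ∀ u, z' u = ρ u * sin u := fun u => mul_comm _ _
  have hV : ∀ u, ρ u ^ 2 = (lam κ (x u) * rad τ (x u) * x' u) ^ 2 + z' u ^ 2 := fun u => by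
    rw [hp, hz'eq]
    linear_combination (-ρ u ^ 2) * sin_sq_add_cos_sq u
  set N : ℝ → Fin 3 → ℝ := fun u => (ρ u)⁻¹ • profileNormal κ τ (x u) (x' u) (z' u) with hN
  have hxper : ∀ u, x (u + 2 * π) = x u := fun u => by simp only [hxdef, sin_add_two_pi]
  have hNper : ∀ u, N (u + 2 * π) = N u := fun u => by
    simp only [hN, hx'def, hz'def, hr, hρ, heightRate, hxdef, sin_add_two_pi, cos_add_two_pi]
  have hrot : ∀ (θ : ℝ) (q : Fin 3 → ℝ), rotation (θ + 2 * π) q = rotation θ q := fun θ q => by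
    simp only [rotation, sin_add_two_pi, cos_add_two_pi]
  have hxi : ∀ θ, rotation θ xi = xi := fun θ => by
    ext i; fin_cases i <;> simp [rotation, xi]
  have hlamc : Continuous fun u => lam κ (x u) := by
    refine continuous_const.div ?_ fun u => (hm u).ne'
    exact continuous_const.add (continuous_const.mul (hxC.continuous.pow 2))
  have hNc : ∀ i, Continuous fun u => N u i := by
    have h1 := hxC.continuous
    have h2 := hx'C.continuous
    have h3 := hz'C.continuous
    have h4 : Continuous fun u => (ρ u)⁻¹ := hρC.continuous.inv₀ fun u => (hρ0 u).ne'
    have h5 : Continuous fun u => rad τ (x u) :=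
      Real.continuous_sqrt.comp (by fun_prop)
    intro i
    refine h4.mul ?_
    fin_cases i
    · exact (h3.neg).div hlamc fun u => (lam_pos (hm u)).ne'
    · exact (continuous_const.mul h1).mul h2
    · exact (hlamc.mul (h5.pow 2)).mul h2
  refine ⟨hxpos, ⟨two_pi_pos, two_pi_pos, fun u v => ?_, fun u v => ?_, ?_, fun u v => ?_,
    fun u v => ?_⟩, fun u θ => rotation θ (N u), ⟨fun u v => ?_, fun u v => ?_, ?_, fun u v => ?_,
    fun u v => ?_, fun u v => ?_⟩, fun u v => ?_⟩
  · simp only [rotationSurface, hxper, S.height_periodic A h0 u, hzdef]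
  · exact hrot _ _
  · have h1 : ContDiff ℝ 2 fun p : ℝ × ℝ => x p.1 := hxC.comp contDiff_fst
    have h2 : ContDiff ℝ 2 fun p : ℝ × ℝ => z p.1 := hzC.comp contDiff_fst
    refine contDiff_pi.2 fun i => ?_
    fin_cases i
    · simpa [rotationSurface, rotation] using h1.mul (contDiff_cos.comp contDiff_snd)
    · simpa [rotationSurface, rotation] using h1.mul (contDiff_sin.comp contDiff_snd)
    · exact h2
  · exact (rotation_mem_model κ v _).2 (profile_mem_model (hm u))
  · rw [du_rotationSurface hx hz, dv_rotationSurface, LinearIndependent.pair_iff]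
    intro s t hst
    have e0 := congrFun hst 0
    have e1 := congrFun hst 1
    have e2 := congrFun hst 2
    simp [rotation] at e0 e1 e2
    have e3 : t * x u = 0 := by
      linear_combination (-sin v) * e0 + cos v * e1 - t * x u * sin_sq_add_cos_sq v
    have e4 : s * x' u = 0 := by
      linear_combination cos v * e0 + sin v * e1 - s * x' u * sin_sq_add_cos_sq v
    refine ⟨?_, (mul_eq_zero.1 e3).resolve_right (hxpos u).ne'⟩
    by_contra hs
    have e5 : cos u = 0 := (mul_eq_zero.1 ((mul_eq_zero.1 e4).resolve_left hs)).resolve_left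
      (hr0 u).ne'
    have e6 : z' u = 0 := e2.resolve_left hs
    rw [hz'eq] at e6
    have e7 := (mul_eq_zero.1 e6).resolve_left (hρ0 u).ne'
    have := sin_sq_add_cos_sq u
    rw [e5, e7] at this
    norm_num at this
  · simp only [hNper]
  · exact hrot _ _
  · have h1 := fun i => (hNc i).comp (continuous_fst (X := ℝ) (Y := ℝ))
    have h2 : Continuous fun p : ℝ × ℝ => cos p.2 := by fun_prop
    have h3 : Continuous fun p : ℝ × ℝ => sin p.2 := by fun_prop
    refine continuous_pi fun i => ?_
    fin_cases i
    · exact ((h1 0).mul h2).sub ((h1 1).mul h3)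
    · exact ((h1 0).mul h3).add ((h1 1).mul h2)
    · exact h1 2
  · have := hρ0 u
    rw [rotationSurface, metric_rotation, hN, metric_smul_left, metric_smul_right,
      metric_profileNormal_self _ _ _ (hm u), ← hV]
    field_simp
  · rw [du_rotationSurface hx hz, rotationSurface, metric_rotation, hN, metric_smul_left,
      metric_profileNormal_du _ _ _ (hm u), mul_zero]
  · rw [dv_rotationSurface, rotationSurface, metric_rotation, hN, metric_smul_left,
      metric_profileNormal_dv, mul_zero]
  · have hρu := hρ0 u
    have hang : angle κ τ (rotationSurface x z) (fun u θ => rotation θ (N u)) u v =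
        cos u / rad τ (x u) := by
      rw [angle, ← hxi v, rotationSurface, metric_rotation, hN, metric_smul_left,
        metric_profileNormal_xi]
      have h1 := rad_pos τ (x u)
      have h2 := hp u
      field_simp
      linear_combination h2
    have hpd : HasDerivAt (fun t => lam κ (x t) * rad τ (x t) * x' t)
        (deriv ρ u * cos u - ρ u * sin u) u := by
      rw [funext hp]
      exact ((hd ρ hρC u).mul (hasDerivAt_cos u)).congr_deriv (by ring)
    have hzd : deriv z' u = deriv ρ u * sin u + ρ u * cos u := by
      rw [funext hz'eq]
      exact ((hd ρ hρC u).mul (hasDerivAt_sin u)).deriv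
    rw [meanCurvature_rotationSurface_frame hx hz (hd x' hx'C) (hd z' hz'C) (hxpos u) (hm u)
      (hV u) (by positivity) rfl hpd, hang, hp, hzd, hz'eq]
    have hy : (cos u / rad τ (x u)) ^ 2 = angleSq τ (sin u) (x u) := by
      rw [div_pow, rad_sq, cos_sq', angleSq]
    have hT : turning κ τ f (sin u) (x u) = rad τ (x u) / ρ u := by
      have h1 := A.turning_pos (τ := τ) (sin_mem_Icc u) (hmem u)
      have h2 := rad_pos τ (x u)
      simp only [hρ, verticalRate]
      simp only [hxdef] at h1 h2 ⊢
      field_simp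
    have hfe : f (angleSq τ (sin u) (x u)) = rad τ (x u) / ρ u + crv κ (x u) * sin u := by
      rw [← hT, turning]; ring
    change _ = f ((cos u / rad τ (x u)) ^ 2) / 2
    rw [hy, hfe]
    field_simp
    linear_combination (ρ u * rad τ (x u)) * sin_sq_add_cos_sq u

end IsArc

end EKT

end

theorem theorem2 (κ τ : ℝ) (hκ : κ ≤ 0) (hτ : 0 < τ) :
    (∀ h : ℝ → ℝ, EKT.PrescribedClass κ h → AntitoneOn h (Set.Icc (-1) 0) →
      ¬ ∃ (T : ℝ) (x z : ℝ → ℝ), EKT.IsRotationalHTorus κ τ h T x z) ∧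
    (∃ h : ℝ → ℝ, EKT.PrescribedClass κ h ∧
      ∃ (T : ℝ) (x z : ℝ → ℝ), EKT.IsRotationalHTorus κ τ h T x z ∧
        EKT.IsInjectiveTorus T (2 * Real.pi) (EKT.rotationSurface x z)) := by
  refine ⟨fun h hC hanti ⟨T, x, z, H⟩ => EKT.not_isRotationalHTorus hκ hC hanti T x z H, ?_⟩
  obtain ⟨ℓ, ξ, f, X, A, S, h0⟩ := EKT.exists_isArc_integral_eq_zero hκ hτ
  exact ⟨_, A.prescribedClass, _, _, _, S.isRotationalHTorus A h0,
    S.isInjectiveTorus A h0⟩
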